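/- Let $O=(X,T,Y)$ have law $P$, where $X$ takes values in an arbitrary measurable space, $T\in\{0,1\}$ and $Y\in\mathbb R$. Fix $t\in\{0,1\}$, a measurable tilting function $s_t:\mathbb R\to\mathbb R$ and a sensitivity parameter $\gamma_t\in\mathbb R$. For a law $Q$ of $O$ write $\pi_{t}(X)=Q(T=t\mid X)$, $\mu_t(g(Y);X)=E_Q[g(Y)\mid T=t,X]$, $w(Y)=\exp\{\gamma_t s_t(Y)\}$, and $$\psi_t(Q)=\int \Big\{\mu_t(Y;x)\,\pi_t(x)+\frac{\mu_t(Y w(Y);x)}{\mu_t(w(Y);x)}\,\pi_{1-t}(x)\Big\}\,dF(x),$$ where $F$ is the law of $X$ under $Q$. Assume that, under $P$, $\pi_0(X)>0$ and $\pi_1(X)>0$ almost surely; that for almost every $x$ the variables $w(Y)$ and $Y w(Y)$ are integrable under the conditional law of $Y$ given $T=t$, $X=x$; and that the three variables $$\mathbb I(T=t)\,Y,\qquad \mathbb I(T=t)\,\frac{\pi_{1-t}(X)}{\pi_t(X)}\,\frac{w(Y)}{\mu_t(w(Y);X)}\Big\{Y-\frac{\mu_t(Yw(Y);X)}{\mu_t(w(Y);X)}\Big\},\qquad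 \mathbb I(T=1-t)\,\frac{\mu_t(Yw(Y);X)}{\mu_t(w(Y);X)}$$ have finite second moments under $P$. (i) If $Y(0),Y(1)$ are potential outcomes, defined on some probability space together with $(X,T,Y)\sim P$, such that $Y=Y(T)$ almost surely and, for almost every $x$, $dF(Y(t)\mid T=1-t,X=x)=dF(Y(t)\mid T=t,X=x)\,\exp\{\gamma_t s_t(Y(t))\}/C_t(\gamma_t;x)$ with $C_t(\gamma_t;x)=E[\exp\{\gamma_t s_t(Y(t))\}\mid T=t,X=x]$, then $Y(t)$ is integrable and $E[Y(t)]=\psi_t(P)$. (ii) The functional $\psi_t$ has at $P$ the nonparametric efficient influence function $$\begin{aligned}\phi_t(P)(O)={}&\mathbb I(T=t)\Big\{Y+Y\,\frac{\pi_{1-t}(X)}{\pi_t(X)}\,\frac{w(Y)}{\mu_t(w(Y);X)}-\frac{\pi_{1-t}(X)}{\pi_t(X)}\,\frac{w(Y)\,\mu_t(Yw(Y);X)}{\mu_t(w(Y);X)^2}\Big\}\\&+\mathbb I(T=1-t)\,\frac{\mu_t(Yw(Y);X)}{\mu_t(w(Y);X)}-\psi_t(P).\end{aligned}$$ That is: call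 a family $(P_\theta)$ of laws of $O$, indexed by real $\theta$, with $P_0=P$ a regular submodel with score $g\in L^2(P)$ if for some constants $0<c\le C<\infty$ one has $cP\le P_\theta\le CP$ for all $\theta$ near $0$ and $\theta^{-1}(\sqrt{dP_\theta/dP}-1)\to g/2$ in $L^2(P)$ as $\theta\to0$. Then $\phi_t(P)$ has mean zero and finite variance under $P$; for every regular submodel, $\theta\mapsto\psi_t(P_\theta)$ is differentiable at $0$ with derivative $E_P[\phi_t(P)\,g]$; and $\phi_t(P)$ lies in the closed linear span in $L^2(P)$ of the scores of all regular submodels. Moreover $\phi_t(P)$ is, up to $P$-null sets, the only function with mean zero and finite variance that has this derivative property. -/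

import Mathlib

open MeasureTheory ProbabilityTheory Filter Topology
open scoped NNReal ENNReal

namespace TiltSens

/-! ### Pathwise differentiability in a nonparametric model -/

section Semiparametric

variable {O : Type*} [MeasurableSpace O]

/-- `path` is a regular one-dimensional parametric submodel through `P` with score `g` at `P`:
a family of laws indexed by a real parameter, equal to `P` at `0`, with likelihood ratio
with respect to `P` bounded away from `0` and `∞` near the parameter value `0`,
and differentiable in quadratic mean at `0` with score `g`. Apart from this regularity the
submodel is arbitrary, so the model is nonparametric. -/
structure IsRegularSubmodel (P : ProbabilityMeasure O) (path : ℝ → ProbabilityMeasure O)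
    (g : O → ℝ) : Prop where
  path_zero : path 0 = P
  memLp_score : MemLp g 2 (P : Measure O)
  bounded_ratio : ∃ c C : ℝ≥0, 0 < c ∧ ∀ᶠ θ in 𝓝 (0 : ℝ),
    c • (P : Measure O) ≤ (path θ : Measure O) ∧ (path θ : Measure O) ≤ C • (P : Measure O)
  quadratic_mean : Tendsto
    (fun θ : ℝ => eLpNorm
      (fun o => (√((path θ : Measure O).rnDeriv (P : Measure O) o).toReal - 1) / θ - g o / 2)
      2 (P : Measure O))
    (𝓝[≠] 0) (𝓝 0)

/-- `φ` is a mean-zero gradient (an influence function) of `Ψ` at `P`: it has mean zero and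
finite variance, and along every regular submodel the derivative of `Ψ` at `P` is the
covariance of `φ` with the score. -/
structure IsInfluenceFunction (Ψ : ProbabilityMeasure O → ℝ) (P : ProbabilityMeasure O)
    (φ : O → ℝ) : Prop where
  memLp : MemLp φ 2 (P : Measure O)
  mean_zero : ∫ o, φ o ∂(P : Measure O) = 0
  hasDerivAt : ∀ (path : ℝ → ProbabilityMeasure O) (g : O → ℝ), IsRegularSubmodel P path g →
    HasDerivAt (fun θ => Ψ (path θ)) (∫ o, φ o * g o ∂(P : Measure O)) 0

/-- The tangent space at `P`: the closed linear span, in `L²(P)`, of the scores at `P` of all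
regular submodels. -/
noncomputable def tangentSpace (P : ProbabilityMeasure O) :
    Submodule ℝ (Lp ℝ 2 (P : Measure O)) :=
  (Submodule.span ℝ {u : Lp ℝ 2 (P : Measure O) |
    ∃ (path : ℝ → ProbabilityMeasure O) (g : O → ℝ),
      IsRegularSubmodel P path g ∧ u =ᵐ[(P : Measure O)] g}).topologicalClosure

/-- `φ` is the nonparametric efficient influence function (canonical gradient) of `Ψ` at `P`:
an influence function that belongs to the tangent space. -/
structure IsEfficientInfluenceFunction (Ψ : ProbabilityMeasure O → ℝ)
    (P : ProbabilityMeasure O) (φ : O → ℝ) : Prop extends IsInfluenceFunction Ψ P φ where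
  mem_tangentSpace : memLp.toLp φ ∈ tangentSpace P

end Semiparametric

/-! ### The observed data `O = (X, T, Y)` and the target -/

section Observed

variable {𝒳 : Type*} [MeasurableSpace 𝒳]

/-- The observed data: covariates `X`, treatment `T ∈ {0, 1}`, outcome `Y`. -/
abbrev Obs (𝒳 : Type*) := 𝒳 × Fin 2 × ℝ

/-- The covariates `X`. -/
def covX (o : Obs 𝒳) : 𝒳 := o.1

/-- The treatment `T`. -/
def trtT (o : Obs 𝒳) : Fin 2 := o.2.1

/-- The outcome `Y`. -/
def outY (o : Obs 𝒳) : ℝ := o.2.2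

/-- `F`, the marginal law of `X`. -/
noncomputable def lawX (P : ProbabilityMeasure (Obs 𝒳)) : Measure 𝒳 :=
  (P : Measure (Obs 𝒳)).map covX

/-- `π_t(x) = P(T = t | X = x)`. -/
noncomputable def propensity (P : ProbabilityMeasure (Obs 𝒳)) (t : Fin 2) (x : 𝒳) : ℝ :=
  (condDistrib trtT covX (P : Measure (Obs 𝒳)) x).real {t}

/-- `F_t(· | x)`, the conditional law of `Y` given `T = t`, `X = x`. -/
noncomputable def condLawY (P : ProbabilityMeasure (Obs 𝒳)) (t : Fin 2) (x : 𝒳) : Measure ℝ :=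
  condDistrib outY (fun o => (covX o, trtT o)) (P : Measure (Obs 𝒳)) (x, t)

/-- `E[g(Y) | T = t, X = x]`. -/
noncomputable def condMean (P : ProbabilityMeasure (Obs 𝒳)) (t : Fin 2) (g : ℝ → ℝ) (x : 𝒳) :
    ℝ :=
  ∫ y, g y ∂(condLawY P t x)

/-- The tilting weight `exp(γ s(y))`. -/
noncomputable def weight (γ : ℝ) (s : ℝ → ℝ) (y : ℝ) : ℝ := Real.exp (γ * s y)

/-- `E[exp(γ s(Y)) | T = t, X = x]`. -/
noncomputable def meanW (P : ProbabilityMeasure (Obs 𝒳)) (t : Fin 2) (γ : ℝ) (s : ℝ → ℝ)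
    (x : 𝒳) : ℝ :=
  condMean P t (weight γ s) x

/-- `E[Y exp(γ s(Y)) | T = t, X = x]`. -/
noncomputable def meanYW (P : ProbabilityMeasure (Obs 𝒳)) (t : Fin 2) (γ : ℝ) (s : ℝ → ℝ)
    (x : 𝒳) : ℝ :=
  condMean P t (fun y => y * weight γ s y) x

/-- The observed-data functional `ψ_t` for tilting function `s` and sensitivity parameter `γ`. -/
noncomputable def psi (t : Fin 2) (γ : ℝ) (s : ℝ → ℝ) (P : ProbabilityMeasure (Obs 𝒳)) : ℝ :=
  ∫ x, (condMean P t (fun y => y) x * propensity P t x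
    + meanYW P t γ s x / meanW P t γ s x * propensity P (1 - t) x) ∂(lawX P)

/-- The function `φ_t(P)`. -/
noncomputable def phi (t : Fin 2) (γ : ℝ) (s : ℝ → ℝ) (P : ProbabilityMeasure (Obs 𝒳))
    (o : Obs 𝒳) : ℝ :=
  (if trtT o = t then
      outY o
      + outY o * (propensity P (1 - t) (covX o) / propensity P t (covX o))
          * (weight γ s (outY o) / meanW P t γ s (covX o))
      - propensity P (1 - t) (covX o) / propensity P t (covX o)
          * (weight γ s (outY o) * meanYW P t γ s (covX o) / meanW P t γ s (covX o) ^ 2)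
    else 0)
  + (if trtT o = 1 - t then meanYW P t γ s (covX o) / meanW P t γ s (covX o) else 0)
  - psi t γ s P

/-- The regularity of the observed-data law: positivity, existence of the two conditional means
that involve the weight, and finite second moments of the three variable terms of `φ_t(P)`. -/
structure IsRegularLaw (t : Fin 2) (γ : ℝ) (s : ℝ → ℝ) (P : ProbabilityMeasure (Obs 𝒳)) :
    Prop where
  positivity : ∀ t' : Fin 2, ∀ᵐ x ∂(lawX P), 0 < propensity P t' x
  integrable_weight : ∀ᵐ x ∂(lawX P), Integrable (weight γ s) (condLawY P t x)
  integrable_mul_weight : ∀ᵐ x ∂(lawX P),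
    Integrable (fun y => y * weight γ s y) (condLawY P t x)
  memLp_outcome : MemLp (fun o : Obs 𝒳 => if trtT o = t then outY o else 0) 2
    (P : Measure (Obs 𝒳))
  memLp_residual : MemLp (fun o : Obs 𝒳 => if trtT o = t then
      propensity P (1 - t) (covX o) / propensity P t (covX o)
        * (weight γ s (outY o) / meanW P t γ s (covX o))
        * (outY o - meanYW P t γ s (covX o) / meanW P t γ s (covX o))
      else 0) 2 (P : Measure (Obs 𝒳))
  memLp_tiltedMean : MemLp (fun o : Obs 𝒳 => if trtT o = 1 - t then
      meanYW P t γ s (covX o) / meanW P t γ s (covX o) else 0) 2 (P : Measure (Obs 𝒳))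

end Observed

/-! ### The exponential-tilting sensitivity model for the potential outcomes -/

section Potential

variable {𝒳 : Type*} [MeasurableSpace 𝒳] {Ω : Type*} [MeasurableSpace Ω]

/-- Covariates `X`, treatment `T`, outcome `Y` and potential outcomes `Y(0)`, `Y(1)` on a
probability space `(Ω, μ)` such that `(X, T, Y)` has law `P`, `Y = Y(T)` (consistency), and
the conditional law of `Y(t)` given `T = 1 - t`, `X` is the exponential tilt
`dF(y | T = t, X) exp(γ s(y)) / E[exp(γ s(Y(t))) | T = t, X]` of the one given `T = t`, `X`. -/
structure IsTiltingModel (t : Fin 2) (γ : ℝ) (s : ℝ → ℝ) (P : ProbabilityMeasure (Obs 𝒳))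
    (μ : Measure Ω) [IsProbabilityMeasure μ] (X : Ω → 𝒳) (T : Ω → Fin 2) (Y : Ω → ℝ)
    (Ypot : Fin 2 → Ω → ℝ) : Prop where
  measurable_X : Measurable X
  measurable_T : Measurable T
  measurable_Y : Measurable Y
  measurable_Ypot : ∀ t', Measurable (Ypot t')
  law : μ.map (fun ω => (X ω, T ω, Y ω)) = (P : Measure (Obs 𝒳))
  consistency : ∀ᵐ ω ∂μ, Y ω = Ypot (T ω) ω
  tilting : ∀ᵐ x ∂(μ.map X),
    condDistrib (Ypot t) (fun ω => (X ω, T ω)) μ (x, 1 - t)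
      = (condDistrib (Ypot t) (fun ω => (X ω, T ω)) μ (x, t)).tilted (fun y => γ * s y)

end Potential

end TiltSens

/-! Write ρ_Q(x) for the mean of Y under the tilted conditional law (`tiltedMean`), so that ψ_t(Q) =
E_Q[1(T=t) Y] + E_Q[1(T=1-t) ρ_Q(X)] (`psi_eq_add`).

Identification: let Q be the law of (X, T, Y(t)). Consistency makes Q agree with P on the arm T = t,
and the tilting assumption makes the conditional mean on the other arm equal to ρ_P. Adding the two
arms gives ψ_t(P).

Derivative: let p be the likelihood ratio of Q to P, with values in [c, C]. Bayes' rule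
(`condLawY_eq_withDensity`) gives ρ_Q - ρ_P = E_P[w (Y - ρ_P) p | t, x] / E_P[w p | t, x]
(`tiltedMean_sub`). The weighted residual has conditional mean zero, so p may be replaced by p - 1
in the numerator. This yields the exact formula `psi_sub`, in which ψ_t(Q) - ψ_t(P) is the integral
against p - 1 of the three variable terms of φ_t, the residual term being multiplied by a factor
that depends on X and p. That factor is at most C/c in absolute value and tends to 1 when p does, so
no second-order remainder has to be estimated. Along a submodel, write p - 1 = (√p + 1)(√p - 1). The
quotient (√p - 1)/θ converges to g/2 in L², while the remaining bounded factors converge almost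
everywhere along a subsequence. Hölder's inequality and dominated convergence then give E_P[φ_t g]
(`tendsto_integral_score`), and the subsequence criterion for limits gives the derivative
(`hasDerivAt_psi`).

Efficiency and uniqueness: every bounded mean-zero function is the score of a linear path (1 + θ g)
P, and these scores suffice to show that only constants are orthogonal to all scores
(`ae_eq_integral_of_orthogonal_scores`). Hence the tangent space contains every mean-zero L²
function, and two gradients differ by a constant of mean zero. -/

namespace TiltSens

/-! ### Disintegration of the observed law over the arms T = t -/

section Arms

variable {𝒳 : Type*} [MeasurableSpace 𝒳]

@[fun_prop] lemma measurable_covX : Measurable (covX : Obs 𝒳 → 𝒳) := measurable_fst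

@[fun_prop] lemma measurable_trtT : Measurable (trtT : Obs 𝒳 → Fin 2) :=
  measurable_fst.comp measurable_snd

@[fun_prop] lemma measurable_outY : Measurable (outY : Obs 𝒳 → ℝ) :=
  measurable_snd.comp measurable_snd

lemma measurableSet_trt (t : Fin 2) : MeasurableSet {o : Obs 𝒳 | trtT o = t} :=
  measurable_trtT (measurableSet_singleton t)

/-- The conditional law of `Y` given `T = t`, `X = x`, as a kernel in `x`. -/
noncomputable def condKernelY (Q : ProbabilityMeasure (Obs 𝒳)) (t : Fin 2) : Kernel 𝒳 ℝ :=
  (condDistrib outY (fun o => (covX o, trtT o)) (Q : Measure (Obs 𝒳))).comap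
    (fun x => (x, t)) (by fun_prop)

instance (Q : ProbabilityMeasure (Obs 𝒳)) (t : Fin 2) : IsMarkovKernel (condKernelY Q t) := by
  unfold condKernelY; infer_instance

lemma condKernelY_apply (Q : ProbabilityMeasure (Obs 𝒳)) (t : Fin 2) (x : 𝒳) :
    condKernelY Q t x = condLawY Q t x := rfl

instance (Q : ProbabilityMeasure (Obs 𝒳)) (t : Fin 2) (x : 𝒳) :
    IsProbabilityMeasure (condLawY Q t x) := by
  rw [← condKernelY_apply]; infer_instance

instance (Q : ProbabilityMeasure (Obs 𝒳)) : IsProbabilityMeasure (lawX Q) := by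
  unfold lawX; exact Measure.isProbabilityMeasure_map measurable_covX.aemeasurable

/-- The law of `X` restricted to the event `T = t`. -/
noncomputable def armX (Q : ProbabilityMeasure (Obs 𝒳)) (t : Fin 2) : Measure 𝒳 :=
  ((Q : Measure (Obs 𝒳)).restrict {o | trtT o = t}).map covX

/-- The law of `(X, Y)` restricted to the event `T = t`. -/
noncomputable def armXY (Q : ProbabilityMeasure (Obs 𝒳)) (t : Fin 2) : Measure (𝒳 × ℝ) :=
  ((Q : Measure (Obs 𝒳)).restrict {o | trtT o = t}).map fun o => (covX o, outY o)

instance (Q : ProbabilityMeasure (Obs 𝒳)) (t : Fin 2) : IsFiniteMeasure (armX Q t) := by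
  unfold armX; infer_instance

instance (Q : ProbabilityMeasure (Obs 𝒳)) (t : Fin 2) : IsFiniteMeasure (armXY Q t) := by
  unfold armXY; infer_instance

lemma propensity_nonneg (Q : ProbabilityMeasure (Obs 𝒳)) (t : Fin 2) (x : 𝒳) :
    0 ≤ propensity Q t x := measureReal_nonneg

@[fun_prop] lemma measurable_propensity (Q : ProbabilityMeasure (Obs 𝒳)) (t : Fin 2) :
    Measurable (propensity Q t) :=
  (Kernel.measurable_coe _ (measurableSet_singleton t)).ennreal_toReal

lemma armX_eq_withDensity (Q : ProbabilityMeasure (Obs 𝒳)) (t : Fin 2) :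
    armX Q t = (lawX Q).withDensity fun x => ENNReal.ofReal (propensity Q t x) := by
  ext A hA
  rw [withDensity_apply _ hA, lawX]
  have h : ∀ x, ENNReal.ofReal (propensity Q t x)
      = condDistrib trtT covX (Q : Measure (Obs 𝒳)) x {t} := fun x => ofReal_measureReal
  simp_rw [h]
  rw [setLIntegral_map hA (Kernel.measurable_coe _ (measurableSet_singleton t)) measurable_covX,
    setLIntegral_preimage_condDistrib measurable_covX measurable_trtT.aemeasurable
    (measurableSet_singleton t) hA, armX, Measure.map_apply measurable_covX hA,
    Measure.restrict_apply (measurable_covX hA)]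
  rfl

lemma armX_le_lawX (Q : ProbabilityMeasure (Obs 𝒳)) (t : Fin 2) : armX Q t ≤ lawX Q :=
  Measure.map_mono Measure.restrict_le_self measurable_covX

/-- Under positivity an arm has the same null sets of covariates as the whole population.
Conditional laws are determined only up to null sets of their arm, and this carries such statements
over to F. -/
lemma lawX_absolutelyContinuous_armX {Q : ProbabilityMeasure (Obs 𝒳)} {t : Fin 2}
    (h : ∀ᵐ x ∂(lawX Q), 0 < propensity Q t x) : lawX Q ≪ armX Q t := by
  rw [armX_eq_withDensity]
  refine withDensity_absolutelyContinuous' (by fun_prop) ?_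
  filter_upwards [h] with x hx
  simpa using hx

lemma integral_armX (Q : ProbabilityMeasure (Obs 𝒳)) (t : Fin 2) (h : 𝒳 → ℝ) :
    ∫ x, h x ∂(armX Q t) = ∫ x, propensity Q t x * h x ∂(lawX Q) := by
  rw [armX_eq_withDensity, integral_withDensity_eq_integral_toReal_smul (by fun_prop) (by simp)]
  simp [ENNReal.toReal_ofReal (propensity_nonneg Q t _)]

lemma integrable_armX_iff (Q : ProbabilityMeasure (Obs 𝒳)) (t : Fin 2) {h : 𝒳 → ℝ} :
    Integrable h (armX Q t) ↔ Integrable (fun x => propensity Q t x * h x) (lawX Q) := by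
  rw [armX_eq_withDensity, integrable_withDensity_iff_integrable_smul' (by fun_prop) (by simp)]
  simp [ENNReal.toReal_ofReal (propensity_nonneg Q t _)]

/-- This is the disintegration of ((X, T), Y) along (X, T), evaluated on sets contained in the slice
T = t. -/
lemma armXY_eq_compProd (Q : ProbabilityMeasure (Obs 𝒳)) (t : Fin 2) :
    armXY Q t = armX Q t ⊗ₘ condKernelY Q t := by
  ext A hA
  have h := compProd_map_condDistrib (X := fun o : Obs 𝒳 => (covX o, trtT o)) (Y := outY)
    (mβ := inferInstance) (μ := (Q : Measure (Obs 𝒳))) (by fun_prop)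
  have hB : MeasurableSet {z : (𝒳 × Fin 2) × ℝ | z.1.2 = t ∧ (z.1.1, z.2) ∈ A} :=
    ((measurable_snd.comp measurable_fst) (measurableSet_singleton t)).inter
      ((by fun_prop : Measurable fun z : (𝒳 × Fin 2) × ℝ => (z.1.1, z.2)) hA)
  have h1 := congrArg (fun m => m {z : (𝒳 × Fin 2) × ℝ | z.1.2 = t ∧ (z.1.1, z.2) ∈ A}) h
  beta_reduce at h1
  rw [Measure.map_apply (by fun_prop) hB, Measure.compProd_apply hB,
    lintegral_map (Kernel.measurable_kernel_prodMk_left hB) (by fun_prop)] at h1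
  rw [Measure.compProd_apply hA, armX, lintegral_map (Kernel.measurable_kernel_prodMk_left hA)
    (by fun_prop), armXY, Measure.map_apply (by fun_prop) hA,
    Measure.restrict_apply ((by fun_prop : Measurable fun o : Obs 𝒳 => (covX o, outY o)) hA),
    ← lintegral_indicator (measurableSet_trt t)]
  have h2 : (fun o : Obs 𝒳 => (covX o, outY o)) ⁻¹' A ∩ {o | trtT o = t}
      = (fun o : Obs 𝒳 => ((covX o, trtT o), outY o)) ⁻¹'
        {z : (𝒳 × Fin 2) × ℝ | z.1.2 = t ∧ (z.1.1, z.2) ∈ A} := by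
    ext o; simp [and_comm]
  rw [h2, ← h1]
  refine lintegral_congr fun o => ?_
  by_cases ho : trtT o = t
  · rw [Set.indicator_of_mem (by exact ho)]
    subst ho
    simp only [condKernelY, Kernel.comap_apply]
    congr 1
    ext y; simp
  · rw [Set.indicator_of_notMem (by exact ho)]
    have : (Prod.mk (covX o, trtT o) ⁻¹' {z : (𝒳 × Fin 2) × ℝ | z.1.2 = t ∧ (z.1.1, z.2) ∈ A})
      = ∅ := by
      ext y; simp [ho]
    rw [this, measure_empty]

/-- Uniqueness of disintegration with real-valued outcome: a conditional law is identified by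
exhibiting a kernel that reproduces the arm. -/
lemma condKernelY_ae_eq {Q : ProbabilityMeasure (Obs 𝒳)} {t : Fin 2} {η : Kernel 𝒳 ℝ}
    [IsFiniteKernel η] (h : armXY Q t = armX Q t ⊗ₘ η) :
    ∀ᵐ x ∂(armX Q t), condLawY Q t x = η x := by
  have := Kernel.ae_eq_of_compProd_eq ((armXY_eq_compProd Q t).symm.trans h)
  filter_upwards [this] with x hx
  rw [← hx, condKernelY_apply]

lemma measurable_section {f : Obs 𝒳 → ℝ} (hf : Measurable f) (t : Fin 2) :
    Measurable fun z : 𝒳 × ℝ => f (z.1, t, z.2) :=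
  hf.comp (measurable_fst.prodMk (measurable_const.prodMk measurable_snd))

omit [MeasurableSpace 𝒳] in
lemma indicator_arm_eq (t : Fin 2) (f : Obs 𝒳 → ℝ) :
    (fun o : Obs 𝒳 => if trtT o = t then f o else 0)
      = {o : Obs 𝒳 | trtT o = t}.indicator fun o => f (covX o, t, outY o) := by
  ext o
  by_cases ho : trtT o = t
  · rw [if_pos ho, Set.indicator_of_mem (by exact ho)]
    subst ho; rfl
  · rw [if_neg ho, Set.indicator_of_notMem (by exact ho)]

lemma integrable_arm_iff (Q : ProbabilityMeasure (Obs 𝒳)) (t : Fin 2) {f : Obs 𝒳 → ℝ}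
    (hf : Measurable f) :
    Integrable (fun o => if trtT o = t then f o else 0) (Q : Measure (Obs 𝒳)) ↔
      Integrable (fun z : 𝒳 × ℝ => f (z.1, t, z.2)) (armX Q t ⊗ₘ condKernelY Q t) := by
  rw [indicator_arm_eq, integrable_indicator_iff (measurableSet_trt t), ← armXY_eq_compProd, armXY,
    integrable_map_measure (measurable_section hf t).aestronglyMeasurable (by fun_prop)]
  rfl

lemma integral_arm (Q : ProbabilityMeasure (Obs 𝒳)) (t : Fin 2) {f : Obs 𝒳 → ℝ}
    (hf : Measurable f)
    (hi : Integrable (fun o => if trtT o = t then f o else 0) (Q : Measure (Obs 𝒳))) :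
    ∫ o, (if trtT o = t then f o else 0) ∂(Q : Measure (Obs 𝒳))
      = ∫ x, ∫ y, f (x, t, y) ∂(condLawY Q t x) ∂(armX Q t) := by
  have h := Measure.integral_compProd ((integrable_arm_iff Q t hf).1 hi)
  simp only [condKernelY_apply] at h
  rw [← h, ← armXY_eq_compProd, armXY, integral_map (by fun_prop)
    (measurable_section hf t).aestronglyMeasurable, indicator_arm_eq, integral_indicator (measurableSet_trt t)]

lemma integral_arm_covX (Q : ProbabilityMeasure (Obs 𝒳)) (t : Fin 2) {f : 𝒳 → ℝ}
    (hf : Measurable f) :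
    ∫ o, (if trtT o = t then f (covX o) else 0) ∂(Q : Measure (Obs 𝒳))
      = ∫ x, f x ∂(armX Q t) := by
  rw [armX, integral_map (by fun_prop) (by fun_prop), ← integral_indicator (measurableSet_trt t)]
  simp only [Set.indicator_apply, Set.mem_ofPred_eq]

lemma integrable_arm_covX_iff (Q : ProbabilityMeasure (Obs 𝒳)) (t : Fin 2) {f : 𝒳 → ℝ}
    (hf : Measurable f) :
    Integrable (fun o => if trtT o = t then f (covX o) else 0) (Q : Measure (Obs 𝒳))
      ↔ Integrable f (armX Q t) := by
  rw [armX, integrable_map_measure (by fun_prop) (by fun_prop),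
    ← IntegrableOn, ← integrable_indicator_iff (measurableSet_trt t)]
  refine integrable_congr (ae_of_all _ fun o => ?_)
  simp only [Set.indicator_apply, Set.mem_ofPred_eq, Function.comp_apply]

lemma ae_arm_prod {Q : ProbabilityMeasure (Obs 𝒳)} {t : Fin 2} {S : Set (Obs 𝒳)}
    (hS : MeasurableSet S) (h : (Q : Measure (Obs 𝒳)) S = 0) :
    ∀ᵐ z ∂(armXY Q t), ((z.1, t, z.2) : Obs 𝒳) ∉ S := by
  have hm : Measurable fun z : 𝒳 × ℝ => ((z.1, t, z.2) : Obs 𝒳) :=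
    measurable_fst.prodMk (measurable_const.prodMk measurable_snd)
  refine (ae_map_iff (f := fun o : Obs 𝒳 => (covX o, outY o)) (by fun_prop) (hm hS).compl).2 ?_
  filter_upwards [ae_restrict_of_ae (measure_eq_zero_iff_ae_notMem.1 h),
    ae_restrict_mem (measurableSet_trt t)] with o ho ht
  obtain rfl : trtT o = t := ht
  exact ho

lemma ae_ae_of_ae_arm {Q : ProbabilityMeasure (Obs 𝒳)} {p : Obs 𝒳 → Prop}
    (h : ∀ᵐ o ∂(Q : Measure (Obs 𝒳)), p o) (t : Fin 2) :
    ∀ᵐ x ∂(armX Q t), ∀ᵐ y ∂(condLawY Q t x), p (x, t, y) := by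
  -- The predicate need not be measurable, so its exceptional set is first enlarged to a measurable
  -- null set.
  obtain ⟨S, hS, hS', hS0⟩ := exists_measurable_superset_of_null (ae_iff.1 h)
  have h2 := ae_arm_prod (t := t) hS' hS0
  rw [armXY_eq_compProd] at h2
  filter_upwards [Measure.ae_ae_of_ae_compProd h2] with x hx
  filter_upwards [hx] with y hy
  by_contra hc
  exact hy (hS hc)

@[fun_prop] lemma measurable_condMean (Q : ProbabilityMeasure (Obs 𝒳)) (t : Fin 2) {g : ℝ → ℝ}
    (hg : Measurable g) : Measurable (condMean Q t g) := by
  have : StronglyMeasurable fun x => ∫ y, g y ∂(condKernelY Q t x) :=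
    (hg.stronglyMeasurable.comp_measurable measurable_snd).integral_kernel_prod_right'
      (f := fun z : 𝒳 × ℝ => g z.2)
  exact this.measurable

lemma measurable_condMean_param (Q : ProbabilityMeasure (Obs 𝒳)) (t : Fin 2) {f : 𝒳 × ℝ → ℝ}
    (hf : Measurable f) : Measurable fun x => ∫ y, f (x, y) ∂(condLawY Q t x) :=
  (hf.stronglyMeasurable.integral_kernel_prod_right' (κ := condKernelY Q t)).measurable

lemma integral_split (Q : ProbabilityMeasure (Obs 𝒳)) (t : Fin 2) {f : Obs 𝒳 → ℝ}
    (h1 : Integrable (fun o => if trtT o = t then f o else 0) (Q : Measure (Obs 𝒳)))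
    (h2 : Integrable (fun o => if trtT o = 1 - t then f o else 0) (Q : Measure (Obs 𝒳))) :
    Integrable f (Q : Measure (Obs 𝒳)) ∧ ∫ o, f o ∂(Q : Measure (Obs 𝒳))
      = ∫ o, (if trtT o = t then f o else 0) ∂(Q : Measure (Obs 𝒳))
        + ∫ o, (if trtT o = 1 - t then f o else 0) ∂(Q : Measure (Obs 𝒳)) := by
  have h : f = fun o => (if trtT o = t then f o else 0) + (if trtT o = 1 - t then f o else 0) := by
    ext o
    have : ∀ a b : Fin 2, (a = b ∧ a ≠ 1 - b) ∨ (a ≠ b ∧ a = 1 - b) := by decide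
    rcases this (trtT o) t with ⟨h, h'⟩ | ⟨h, h'⟩
    · rw [if_pos h, if_neg h', add_zero]
    · rw [if_neg h, if_pos h', zero_add]
  rw [← integral_add h1 h2, ← h]
  refine ⟨?_, rfl⟩
  rw [h]; exact h1.add h2

end Arms

/-! ### Conditional laws under a change of measure with bounded likelihood ratio -/

section Density

variable {𝒳 : Type*} [MeasurableSpace 𝒳]

/-- `Q` has the measurable likelihood ratio `p` with respect to `P`, with values in `[c, C]`. -/
structure HasBoundedRatio (P Q : ProbabilityMeasure (Obs 𝒳)) (p : Obs 𝒳 → ℝ) (c C : ℝ) : Prop where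
  pos : 0 < c
  measurable : Measurable p
  lower : ∀ o, c ≤ p o
  upper : ∀ o, p o ≤ C
  eq_withDensity : (Q : Measure (Obs 𝒳))
    = (P : Measure (Obs 𝒳)).withDensity fun o => ENNReal.ofReal (p o)

variable {P Q : ProbabilityMeasure (Obs 𝒳)} {p : Obs 𝒳 → ℝ} {c C : ℝ}

/-- The conditional mean under `P` of `g(Y)` times the likelihood ratio, given `T = t`, `X = x`. -/
noncomputable def ratioMean (P : ProbabilityMeasure (Obs 𝒳)) (p : Obs 𝒳 → ℝ) (t : Fin 2)
    (g : ℝ → ℝ) (x : 𝒳) : ℝ :=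
  ∫ y, g y * p (x, t, y) ∂(condLawY P t x)

lemma measurable_ratioMean (P : ProbabilityMeasure (Obs 𝒳)) (t : Fin 2) {g : ℝ → ℝ}
    (hg : Measurable g) (hp : Measurable p) : Measurable (ratioMean P p t g) :=
  measurable_condMean_param P t (f := fun z : 𝒳 × ℝ => g z.2 * p (z.1, t, z.2))
    ((hg.comp measurable_snd).mul (measurable_section hp t))

namespace HasBoundedRatio

lemma nonneg (h : HasBoundedRatio P Q p c C) (o : Obs 𝒳) : 0 ≤ p o := h.pos.le.trans (h.lower o)

lemma measurable_fiber (h : HasBoundedRatio P Q p c C) (x : 𝒳) (t : Fin 2) :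
    Measurable fun y => p (x, t, y) :=
  (measurable_section h.measurable t).comp (measurable_const.prodMk measurable_id)

lemma integrable_fiber_mul (h : HasBoundedRatio P Q p c C) {x : 𝒳} {t : Fin 2} {g : ℝ → ℝ}
    (hg : Integrable g (condLawY P t x)) :
    Integrable (fun y => g y * p (x, t, y)) (condLawY P t x) := by
  refine hg.mul_bdd (c := C) (h.measurable_fiber x t).aestronglyMeasurable
    (ae_of_all _ fun y => ?_)
  rw [Real.norm_of_nonneg (h.nonneg _)]
  exact h.upper _

lemma integrable_fiber (h : HasBoundedRatio P Q p c C) (x : 𝒳) (t : Fin 2) :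
    Integrable (fun y => p (x, t, y)) (condLawY P t x) := by
  simpa using h.integrable_fiber_mul (x := x) (t := t) (integrable_const (1 : ℝ))

lemma lower_le_ratioMean (h : HasBoundedRatio P Q p c C) {x : 𝒳} {t : Fin 2} {g : ℝ → ℝ}
    (hg : Integrable g (condLawY P t x)) (hg0 : ∀ y, 0 ≤ g y) :
    c * condMean P t g x ≤ ratioMean P p t g x := by
  rw [condMean, ratioMean, ← integral_const_mul]
  refine integral_mono (hg.const_mul c) (h.integrable_fiber_mul hg) fun y => ?_
  simp only
  rw [mul_comm]
  exact mul_le_mul_of_nonneg_left (h.lower _) (hg0 y)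

lemma ratioMean_le_upper (h : HasBoundedRatio P Q p c C) {x : 𝒳} {t : Fin 2} {g : ℝ → ℝ}
    (hg : Integrable g (condLawY P t x)) (hg0 : ∀ y, 0 ≤ g y) :
    ratioMean P p t g x ≤ C * condMean P t g x := by
  rw [condMean, ratioMean, ← integral_const_mul]
  refine integral_mono (h.integrable_fiber_mul hg) (hg.const_mul C) fun y => ?_
  simp only
  rw [mul_comm C]
  exact mul_le_mul_of_nonneg_left (h.upper _) (hg0 y)

lemma ratioMean_one_mem (h : HasBoundedRatio P Q p c C) (t : Fin 2) (x : 𝒳) :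
    ratioMean P p t (fun _ => 1) x ∈ Set.Icc c C := by
  have h1 := h.lower_le_ratioMean (x := x) (t := t) (integrable_const (1 : ℝ)) (fun _ => zero_le_one)
  have h2 := h.ratioMean_le_upper (x := x) (t := t) (integrable_const (1 : ℝ)) (fun _ => zero_le_one)
  simp only [condMean, integral_const, probReal_univ, smul_eq_mul, mul_one] at h1 h2
  exact ⟨h1, h2⟩

lemma integral_eq (h : HasBoundedRatio P Q p c C) (f : Obs 𝒳 → ℝ) :
    ∫ o, f o ∂(Q : Measure (Obs 𝒳)) = ∫ o, p o * f o ∂(P : Measure (Obs 𝒳)) := by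
  rw [h.eq_withDensity, integral_withDensity_eq_integral_toReal_smul
    h.measurable.ennreal_ofReal (by simp)]
  simp [ENNReal.toReal_ofReal (h.nonneg _)]

lemma integrable_iff (h : HasBoundedRatio P Q p c C) {f : Obs 𝒳 → ℝ} :
    Integrable f (Q : Measure (Obs 𝒳)) ↔
      Integrable (fun o => p o * f o) (P : Measure (Obs 𝒳)) := by
  rw [h.eq_withDensity, integrable_withDensity_iff_integrable_smul'
    h.measurable.ennreal_ofReal (by simp)]
  simp [ENNReal.toReal_ofReal (h.nonneg _)]

lemma integrable_mul (h : HasBoundedRatio P Q p c C) {f : Obs 𝒳 → ℝ}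
    (hf : Integrable f (P : Measure (Obs 𝒳))) :
    Integrable (fun o => p o * f o) (P : Measure (Obs 𝒳)) := by
  refine hf.bdd_mul (c := C) h.measurable.aestronglyMeasurable (ae_of_all _ fun o => ?_)
  rw [Real.norm_of_nonneg (h.nonneg _)]
  exact h.upper _

lemma armXY_eq_withDensity (h : HasBoundedRatio P Q p c C) (t : Fin 2) :
    armXY Q t = (armXY P t).withDensity fun z => ENNReal.ofReal (p (z.1, t, z.2)) := by
  have hm := (measurable_section h.measurable t).ennreal_ofReal
  have hφ : Measurable fun o : Obs 𝒳 => (covX o, outY o) := by fun_prop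
  ext A hA
  rw [withDensity_apply _ hA, armXY, armXY, Measure.map_apply hφ hA,
    setLIntegral_map hA hm hφ, Measure.restrict_apply (hφ hA), h.eq_withDensity,
    withDensity_apply _ ((hφ hA).inter (measurableSet_trt t)),
    Measure.restrict_restrict (hφ hA)]
  refine setLIntegral_congr_fun ((hφ hA).inter (measurableSet_trt t)) ?_
  rintro o ⟨-, ho⟩
  obtain rfl : trtT o = t := ho
  rfl

lemma armX_eq_map (P : ProbabilityMeasure (Obs 𝒳)) (t : Fin 2) :
    armX P t = (armXY P t).map Prod.fst := by
  rw [armXY_eq_compProd]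
  exact (Measure.fst_compProd _ _).symm

lemma ofReal_ratioMean_one (h : HasBoundedRatio P Q p c C) (t : Fin 2) (x : 𝒳) :
    ENNReal.ofReal (ratioMean P p t (fun _ => 1) x)
      = ∫⁻ y, ENNReal.ofReal (p (x, t, y)) ∂(condLawY P t x) := by
  simp only [ratioMean, one_mul]
  exact ofReal_integral_eq_lintegral_ofReal (h.integrable_fiber x t)
    (ae_of_all _ fun y => h.nonneg _)

/-- Integrating y out of the likelihood ratio on the arm leaves its conditional mean as the density
of the covariates. -/
lemma armX_eq_withDensity (h : HasBoundedRatio P Q p c C) (t : Fin 2) :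
    armX Q t = (armX P t).withDensity
      fun x => ENNReal.ofReal (ratioMean P p t (fun _ => 1) x) := by
  have hm := (measurable_section h.measurable t).ennreal_ofReal
  ext A hA
  rw [armX_eq_map, h.armXY_eq_withDensity, Measure.map_apply measurable_fst hA,
    withDensity_apply _ (measurable_fst hA), withDensity_apply _ hA, armXY_eq_compProd,
    ← Set.prod_univ, Measure.setLIntegral_compProd hm hA MeasurableSet.univ]
  simp only [h.ofReal_ratioMean_one, Measure.restrict_univ, condKernelY_apply]

/-- The conditional law of the outcome under the tilted law is the tilted conditional law. -/
lemma condLawY_eq_withDensity (h : HasBoundedRatio P Q p c C) (t : Fin 2) :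
    ∀ᵐ x ∂(armX P t), condLawY Q t x = (condLawY P t x).withDensity fun y =>
      ENNReal.ofReal (p (x, t, y) / ratioMean P p t (fun _ => 1) x) := by
  set M : 𝒳 → ℝ := ratioMean P p t (fun _ => 1) with hM
  have hMm : Measurable M := measurable_ratioMean P t measurable_const h.measurable
  have hMpos : ∀ x, 0 < M x := fun x => h.pos.trans_le (h.ratioMean_one_mem t x).1
  have hpm := measurable_section h.measurable t
  have hq : Measurable (Function.uncurry fun x y => ENNReal.ofReal (p (x, t, y) / M x)) :=
    (hpm.div (hMm.comp measurable_fst)).ennreal_ofReal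
  have hmass : ∀ x, (condKernelY P t).withDensity
      (fun x y => ENNReal.ofReal (p (x, t, y) / M x)) x Set.univ = 1 := by
    intro x
    rw [Kernel.withDensity_apply' _ hq, Measure.restrict_univ]
    simp_rw [ENNReal.ofReal_div_of_pos (hMpos x), div_eq_mul_inv]
    rw [lintegral_mul_const _ (h.measurable_fiber x t).ennreal_ofReal, condKernelY_apply,
      ← h.ofReal_ratioMean_one, ENNReal.mul_inv_cancel (by simpa using hMpos x) (by simp)]
  have : IsMarkovKernel ((condKernelY P t).withDensity
      fun x y => ENNReal.ofReal (p (x, t, y) / M x)) := ⟨fun x => ⟨hmass x⟩⟩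
  -- Uniqueness of the kernel holds almost everywhere under Q's arm; the density being positive,
  -- this transfers to P's arm.
  have hac : armX P t ≪ armX Q t := by
    rw [h.armX_eq_withDensity]
    refine withDensity_absolutelyContinuous' hMm.ennreal_ofReal.aemeasurable (ae_of_all _ ?_)
    intro x
    simpa using hMpos x
  have key : armXY Q t = armX Q t ⊗ₘ ((condKernelY P t).withDensity
      fun x y => ENNReal.ofReal (p (x, t, y) / M x)) := by
    ext A hA
    rw [Measure.compProd_apply hA, h.armX_eq_withDensity,
      lintegral_withDensity_eq_lintegral_mul _ hMm.ennreal_ofReal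
        (Kernel.measurable_kernel_prodMk_left hA), h.armXY_eq_withDensity, withDensity_apply _ hA,
      armXY_eq_compProd, ← lintegral_indicator hA,
      Measure.lintegral_compProd (hpm.ennreal_ofReal.indicator hA)]
    -- The normaliser M x in the kernel cancels against the density M x of the covariates.
    refine lintegral_congr fun x => ?_
    have hAx : MeasurableSet (Prod.mk x ⁻¹' A) := measurable_prodMk_left hA
    rw [Pi.mul_apply, Kernel.withDensity_apply' _ hq,
      ← lintegral_const_mul _ ((h.measurable_fiber x t).div_const _).ennreal_ofReal,
      ← lintegral_indicator hAx]
    refine lintegral_congr fun y => ?_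
    by_cases hy : (x, y) ∈ A
    · rw [Set.indicator_of_mem hy, Set.indicator_of_mem (by exact hy),
        ← ENNReal.ofReal_mul (hMpos x).le, mul_div_cancel₀ _ (hMpos x).ne']
    · rw [Set.indicator_of_notMem hy, Set.indicator_of_notMem (by exact hy)]
  filter_upwards [hac.ae_le (condKernelY_ae_eq key)] with x hx
  rw [hx, Kernel.withDensity_apply _ hq, condKernelY_apply]

/-- The exceptional null set does not depend on g, because the conditional laws themselves agree as
measures. -/
lemma condMean_eq (h : HasBoundedRatio P Q p c C) (t : Fin 2) :
    ∀ᵐ x ∂(armX P t), ∀ g : ℝ → ℝ,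
      condMean Q t g x = ratioMean P p t g x / ratioMean P p t (fun _ => 1) x := by
  filter_upwards [h.condLawY_eq_withDensity t] with x hx g
  have hMpos : 0 < ratioMean P p t (fun _ => 1) x := h.pos.trans_le (h.ratioMean_one_mem t x).1
  generalize ratioMean P p t (fun _ => 1) x = M at hx hMpos ⊢
  rw [condMean, hx, integral_withDensity_eq_integral_toReal_smul
    ((h.measurable_fiber x t).div_const _).ennreal_ofReal (by simp), ratioMean, ← integral_div]
  refine integral_congr_ae (ae_of_all _ fun y => ?_)
  simp only [smul_eq_mul]
  rw [ENNReal.toReal_ofReal (div_nonneg (h.nonneg _) hMpos.le)]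
  ring

end HasBoundedRatio

end Density

/-! ### The functional as an expectation, and the size of the tilted residual -/

section Functional

variable {𝒳 : Type*} [MeasurableSpace 𝒳] {t : Fin 2} {γ : ℝ} {s : ℝ → ℝ}
  {P Q : ProbabilityMeasure (Obs 𝒳)}

/-- The conditional mean of the outcome under the tilted conditional law. -/
noncomputable def tiltedMean (P : ProbabilityMeasure (Obs 𝒳)) (t : Fin 2) (γ : ℝ) (s : ℝ → ℝ)
    (x : 𝒳) : ℝ :=
  meanYW P t γ s x / meanW P t γ s x

/-- The weighted residual term of the influence function, as a function of the observation. -/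
noncomputable def residual (P : ProbabilityMeasure (Obs 𝒳)) (t : Fin 2) (γ : ℝ) (s : ℝ → ℝ)
    (o : Obs 𝒳) : ℝ :=
  propensity P (1 - t) (covX o) / propensity P t (covX o)
    * (weight γ s (outY o) / meanW P t γ s (covX o)) * (outY o - tiltedMean P t γ s (covX o))

lemma weight_pos (γ : ℝ) (s : ℝ → ℝ) (y : ℝ) : 0 < weight γ s y := Real.exp_pos _

lemma measurable_weight (γ : ℝ) (hs : Measurable s) : Measurable (weight γ s) := by
  unfold weight; fun_prop

lemma measurable_meanW (P : ProbabilityMeasure (Obs 𝒳)) (t : Fin 2) (γ : ℝ) (hs : Measurable s) :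
    Measurable (meanW P t γ s) :=
  measurable_condMean P t (measurable_weight γ hs)

lemma measurable_meanYW (P : ProbabilityMeasure (Obs 𝒳)) (t : Fin 2) (γ : ℝ)
    (hs : Measurable s) : Measurable (meanYW P t γ s) :=
  measurable_condMean P t (measurable_id.mul (measurable_weight γ hs))

lemma measurable_tiltedMean (P : ProbabilityMeasure (Obs 𝒳)) (t : Fin 2) (γ : ℝ)
    (hs : Measurable s) : Measurable (tiltedMean P t γ s) :=
  (measurable_meanYW P t γ hs).div (measurable_meanW P t γ hs)

lemma measurable_residual (P : ProbabilityMeasure (Obs 𝒳)) (t : Fin 2) (γ : ℝ)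
    (hs : Measurable s) : Measurable (residual P t γ s) := by
  have h1 := measurable_weight γ hs
  have h2 := measurable_meanW P t γ hs
  have h3 := measurable_tiltedMean P t γ hs
  unfold residual
  fun_prop

lemma meanW_pos {x : 𝒳} (h : Integrable (weight γ s) (condLawY P t x)) :
    0 < meanW P t γ s x := by
  refine (integral_pos_iff_support_of_nonneg (fun y => (weight_pos γ s y).le) h).2 ?_
  rw [Function.support_eq_univ fun y => (weight_pos γ s y).ne']
  simp

/-- By the tower property, the propensities in the functional become indicators of the arms. -/
lemma psi_eq_add (hs : Measurable s)
    (h1 : Integrable (fun o => if trtT o = t then outY o else 0) (Q : Measure (Obs 𝒳)))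
    (h2 : Integrable (fun o => if trtT o = 1 - t then tiltedMean Q t γ s (covX o) else 0)
      (Q : Measure (Obs 𝒳))) :
    psi t γ s Q = ∫ o, (if trtT o = t then outY o else 0) ∂(Q : Measure (Obs 𝒳))
      + ∫ o, (if trtT o = 1 - t then tiltedMean Q t γ s (covX o) else 0)
        ∂(Q : Measure (Obs 𝒳)) := by
  have h3 : Integrable (condMean Q t fun y => y) (armX Q t) := by
    have h := Integrable.integral_compProd ((integrable_arm_iff Q t measurable_outY).1 h1)
    simp only [Kernel.prodMkLeft_apply, Kernel.const_apply] at h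
    exact h
  have h3' := (integrable_armX_iff Q t).1 h3
  have h4 := (integrable_arm_covX_iff Q (1 - t) (measurable_tiltedMean Q t γ hs)).1 h2
  rw [integral_arm Q t measurable_outY h1,
    integral_arm_covX Q (1 - t) (measurable_tiltedMean Q t γ hs), integral_armX, integral_armX,
    psi]
  erw [← integral_add h3' ((integrable_armX_iff Q (1 - t)).1 h4)]
  refine integral_congr_ae (ae_of_all _ fun x => ?_)
  simp only [tiltedMean, condMean]
  ring

/-- The mean absolute deviation of the outcome under the tilted conditional law. -/
noncomputable def tiltedDeviation (P : ProbabilityMeasure (Obs 𝒳)) (t : Fin 2) (γ : ℝ) (s : ℝ → ℝ)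
    (x : 𝒳) : ℝ :=
  (∫ y, weight γ s y * |y - tiltedMean P t γ s x| ∂(condLawY P t x)) / meanW P t γ s x

/-- The odds π_{1-t}/π_t in the residual move mass from arm t to arm 1 - t, so this integral is
exactly the L¹ norm of the residual term. It later controls both the change of the tilted mean and
the potential outcome on the opposite arm. -/
lemma integrable_tiltedDeviation (hs : Measurable s) (hP : IsRegularLaw t γ s P) :
    Integrable (tiltedDeviation P t γ s) (armX P (1 - t)) := by
  have h1 : Integrable (fun o => if trtT o = t then residual P t γ s o else 0)
      (P : Measure (Obs 𝒳)) := hP.memLp_residual.integrable one_le_two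
  have h2 := ((integrable_arm_iff P t (measurable_residual P t γ hs)).1 h1).norm
  have h3 := (integrable_armX_iff P t).1
    (by simpa only [Kernel.prodMkLeft_apply, Kernel.const_apply] using h2.integral_compProd)
  refine (integrable_armX_iff P (1 - t)).2 (h3.congr ?_)
  filter_upwards [hP.positivity t, hP.integrable_weight] with x hx hw
  have hW := meanW_pos hw
  have h4 : ∀ y, ‖residual P t γ s (x, t, y)‖
      = propensity P (1 - t) x / propensity P t x / meanW P t γ s x
        * (weight γ s y * |y - tiltedMean P t γ s x|) := by
    intro y
    simp only [residual, covX, outY, norm_mul, norm_div, Real.norm_eq_abs]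
    rw [abs_of_nonneg (propensity_nonneg P (1 - t) x), abs_of_pos hx, abs_of_pos hW,
      abs_of_pos (weight_pos γ s y)]
    ring
  simp only [condKernelY_apply, h4]
  rw [integral_const_mul, tiltedDeviation]
  field_simp

end Functional

/-! ### The exact expansion of the functional around P -/

section Expansion

variable {𝒳 : Type*} [MeasurableSpace 𝒳] {t : Fin 2} {γ : ℝ} {s : ℝ → ℝ}
  {P Q : ProbabilityMeasure (Obs 𝒳)} {p : Obs 𝒳 → ℝ} {c C : ℝ}

lemma integral_weighted_residual {x : 𝒳} (hw : Integrable (weight γ s) (condLawY P t x))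
    (hyw : Integrable (fun y => y * weight γ s y) (condLawY P t x)) :
    ∫ y, weight γ s y * (y - tiltedMean P t γ s x) ∂(condLawY P t x) = 0 := by
  have h : (fun y => weight γ s y * (y - tiltedMean P t γ s x))
      = fun y => y * weight γ s y - weight γ s y * tiltedMean P t γ s x := by
    ext y; ring
  rw [h, integral_sub hyw (hw.mul_const _), integral_mul_const]
  change meanYW P t γ s x - meanW P t γ s x * (meanYW P t γ s x / meanW P t γ s x) = 0
  rw [mul_div_cancel₀ _ (meanW_pos hw).ne', sub_self]

lemma integrable_weighted_residual {x : 𝒳} (hw : Integrable (weight γ s) (condLawY P t x))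
    (hyw : Integrable (fun y => y * weight γ s y) (condLawY P t x)) :
    Integrable (fun y => weight γ s y * (y - tiltedMean P t γ s x)) (condLawY P t x) := by
  have h : (fun y => weight γ s y * (y - tiltedMean P t γ s x))
      = fun y => y * weight γ s y - weight γ s y * tiltedMean P t γ s x := by
    ext y; ring
  rw [h]
  exact hyw.sub (hw.mul_const _)

/-- The factor by which the weighted residual is modified away from the base law. -/
noncomputable def residualFactor (P : ProbabilityMeasure (Obs 𝒳)) (p : Obs 𝒳 → ℝ) (t : Fin 2)
    (γ : ℝ) (s : ℝ → ℝ) (x : 𝒳) : ℝ :=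
  meanW P t γ s x / ratioMean P p t (weight γ s) x * ratioMean P p (1 - t) (fun _ => 1) x

lemma measurable_residualFactor (P : ProbabilityMeasure (Obs 𝒳)) (hp : Measurable p) (t : Fin 2)
    (γ : ℝ) (hs : Measurable s) : Measurable (residualFactor P p t γ s) :=
  ((measurable_meanW P t γ hs).div (measurable_ratioMean P t (measurable_weight γ hs) hp)).mul
    (measurable_ratioMean P (1 - t) measurable_const hp)

lemma ae_covX {q : 𝒳 → Prop} (h : ∀ᵐ x ∂(lawX P), q x) :
    ∀ᵐ o ∂(P : Measure (Obs 𝒳)), q (covX o) :=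
  ae_of_ae_map measurable_covX.aemeasurable h

namespace HasBoundedRatio

lemma ratioMean_weight_pos (h : HasBoundedRatio P Q p c C) {x : 𝒳}
    (hw : Integrable (weight γ s) (condLawY P t x)) : 0 < ratioMean P p t (weight γ s) x :=
  (mul_pos h.pos (meanW_pos hw)).trans_le
    (h.lower_le_ratioMean hw fun y => (weight_pos γ s y).le)

lemma meanW_div_le (h : HasBoundedRatio P Q p c C) {x : 𝒳}
    (hw : Integrable (weight γ s) (condLawY P t x)) :
    meanW P t γ s x / ratioMean P p t (weight γ s) x ≤ 1 / c := by
  rw [div_le_div_iff₀ (h.ratioMean_weight_pos hw) h.pos, one_mul, mul_comm]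
  exact h.lower_le_ratioMean hw fun y => (weight_pos γ s y).le

/-- Reweighting by p lowers the mean of w by at worst a factor c, which costs 1/c; the other factor
is a conditional mean of p, at most C. -/
lemma abs_residualFactor_le (h : HasBoundedRatio P Q p c C) {x : 𝒳}
    (hw : Integrable (weight γ s) (condLawY P t x)) :
    |residualFactor P p t γ s x| ≤ C / c := by
  have h1 := h.ratioMean_weight_pos hw
  have h2 := h.ratioMean_one_mem (1 - t) x
  have h3 := h.meanW_div_le hw
  have h4 : 0 ≤ meanW P t γ s x / ratioMean P p t (weight γ s) x :=
    div_nonneg (meanW_pos hw).le h1.le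
  rw [residualFactor, abs_of_nonneg (mul_nonneg h4 (h.pos.le.trans h2.1))]
  calc _ ≤ 1 / c * C := mul_le_mul h3 h2.2 (h.pos.le.trans h2.1) (by have := h.pos; positivity)
    _ = C / c := by ring

/-- The Bayes normaliser is common to the numerator and denominator of the new tilted mean and
cancels. Subtracting the old tilted mean then centres Y inside the integral. -/
lemma tiltedMean_sub (h : HasBoundedRatio P Q p c C) (hP : IsRegularLaw t γ s P) :
    ∀ᵐ x ∂(lawX P), tiltedMean Q t γ s x - tiltedMean P t γ s x
      = (∫ y, weight γ s y * (y - tiltedMean P t γ s x) * p (x, t, y) ∂(condLawY P t x))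
        / ratioMean P p t (weight γ s) x := by
  filter_upwards [(lawX_absolutelyContinuous_armX (hP.positivity t)).ae_le (h.condMean_eq t),
    hP.integrable_weight, hP.integrable_mul_weight] with x hx hw hyw
  have hM : 0 < ratioMean P p t (fun _ => 1) x := h.pos.trans_le (h.ratioMean_one_mem t x).1
  have hD := h.ratioMean_weight_pos hw
  have h1 : tiltedMean Q t γ s x = ratioMean P p t (fun y => y * weight γ s y) x
      / ratioMean P p t (weight γ s) x := by
    rw [tiltedMean, meanYW, meanW, hx, hx, div_div_div_cancel_right₀ hM.ne']
  have h2 : (fun y => weight γ s y * (y - tiltedMean P t γ s x) * p (x, t, y))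
      = fun y => y * weight γ s y * p (x, t, y)
        - tiltedMean P t γ s x * (weight γ s y * p (x, t, y)) := by
    ext y; ring
  rw [h2, integral_sub (h.integrable_fiber_mul hyw) ((h.integrable_fiber_mul hw).const_mul _),
    integral_const_mul, h1]
  change _ = (ratioMean P p t (fun y => y * weight γ s y) x
    - tiltedMean P t γ s x * ratioMean P p t (weight γ s) x) / _
  rw [sub_div, mul_div_cancel_right₀ _ hD.ne']

/-- This makes the change of the tilted mean integrable on the arm 1 - t, with no further moment
assumption on Q. -/
lemma abs_tiltedMean_sub_le (h : HasBoundedRatio P Q p c C) (hP : IsRegularLaw t γ s P) :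
    ∀ᵐ x ∂(lawX P), |tiltedMean Q t γ s x - tiltedMean P t γ s x|
      ≤ C / c * tiltedDeviation P t γ s x := by
  filter_upwards [h.tiltedMean_sub hP, hP.integrable_weight, hP.integrable_mul_weight]
    with x hx hw hyw
  have hi := integrable_weighted_residual hw hyw
  have hD := h.ratioMean_weight_pos hw
  have hW := meanW_pos hw
  have h1 : |∫ y, weight γ s y * (y - tiltedMean P t γ s x) * p (x, t, y) ∂(condLawY P t x)|
      ≤ C * ∫ y, weight γ s y * |y - tiltedMean P t γ s x| ∂(condLawY P t x) := by
    rw [← integral_const_mul]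
    have hi' : Integrable (fun y => weight γ s y * |y - tiltedMean P t γ s x|)
        (condLawY P t x) := by
      refine hi.norm.congr (ae_of_all _ fun y => ?_)
      simp [abs_of_pos (weight_pos γ s y)]
    refine (norm_integral_le_integral_norm _).trans
      (integral_mono (h.integrable_fiber_mul hi).norm (hi'.const_mul C) fun y => ?_)
    simp only [Real.norm_eq_abs, abs_mul, abs_of_pos (weight_pos γ s y), abs_of_nonneg (h.nonneg _)]
    rw [mul_comm]
    exact mul_le_mul_of_nonneg_right (h.upper _)
      (mul_nonneg (weight_pos γ s y).le (abs_nonneg _))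
  have h5 := h.meanW_div_le hw
  have h6 : 0 ≤ C * ∫ y, weight γ s y * |y - tiltedMean P t γ s x| ∂(condLawY P t x) :=
    (abs_nonneg _).trans h1
  rw [hx, abs_div, abs_of_pos hD, tiltedDeviation]
  calc _ ≤ (C * ∫ y, weight γ s y * |y - tiltedMean P t γ s x| ∂(condLawY P t x))
        / ratioMean P p t (weight γ s) x := div_le_div_of_nonneg_right h1 hD.le
    _ = (C * ∫ y, weight γ s y * |y - tiltedMean P t γ s x| ∂(condLawY P t x))
        / meanW P t γ s x * (meanW P t γ s x / ratioMean P p t (weight γ s) x) := by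
      field_simp
    _ ≤ (C * ∫ y, weight γ s y * |y - tiltedMean P t γ s x| ∂(condLawY P t x))
        / meanW P t γ s x * (1 / c) :=
      mul_le_mul_of_nonneg_left h5 (div_nonneg h6 hW.le)
    _ = _ := by ring

/-- The expansion of the functional around the base law, with the remainder absorbed in the
residual factor. -/
lemma psi_sub (h : HasBoundedRatio P Q p c C) (hs : Measurable s) (hP : IsRegularLaw t γ s P) :
    psi t γ s Q - psi t γ s P
      = ∫ o, (if trtT o = t then outY o else 0) * (p o - 1) ∂(P : Measure (Obs 𝒳))
      + ∫ o, (if trtT o = 1 - t then tiltedMean P t γ s (covX o) else 0) * (p o - 1)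
          ∂(P : Measure (Obs 𝒳))
      + ∫ o, (if trtT o = t then residual P t γ s o else 0)
          * residualFactor P p t γ s (covX o) * (p o - 1) ∂(P : Measure (Obs 𝒳)) := by
  have hρ := measurable_tiltedMean P t γ hs
  have hρQ := measurable_tiltedMean Q t γ hs
  have iY : Integrable (fun o => if trtT o = t then outY o else 0) (P : Measure (Obs 𝒳)) :=
    hP.memLp_outcome.integrable one_le_two
  have iρ : Integrable (fun o => if trtT o = 1 - t then tiltedMean P t γ s (covX o) else 0)
      (P : Measure (Obs 𝒳)) := hP.memLp_tiltedMean.integrable one_le_two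
  have iR : Integrable (fun o => if trtT o = t then residual P t γ s o else 0)
      (P : Measure (Obs 𝒳)) := hP.memLp_residual.integrable one_le_two
  have iΔX : Integrable (fun x => tiltedMean Q t γ s x - tiltedMean P t γ s x)
      (armX P (1 - t)) := by
    refine ((integrable_tiltedDeviation hs hP).const_mul (C / c)).mono'
      (hρQ.sub hρ).aestronglyMeasurable ?_
    exact (Measure.absolutelyContinuous_of_le (armX_le_lawX P (1 - t))).ae_le
      (h.abs_tiltedMean_sub_le hP)
  have iΔ : Integrable (fun o => if trtT o = 1 - t then
      tiltedMean Q t γ s (covX o) - tiltedMean P t γ s (covX o) else 0) (P : Measure (Obs 𝒳)) :=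
    (integrable_arm_covX_iff P (1 - t) (hρQ.sub hρ)).2 iΔX
  have eρQ : (fun o : Obs 𝒳 => if trtT o = 1 - t then tiltedMean Q t γ s (covX o) else 0)
      = fun o => (if trtT o = 1 - t then tiltedMean P t γ s (covX o) else 0)
        + (if trtT o = 1 - t then
          tiltedMean Q t γ s (covX o) - tiltedMean P t γ s (covX o) else 0) := by
    ext o; split_ifs <;> ring
  have iρQ : Integrable (fun o => if trtT o = 1 - t then tiltedMean Q t γ s (covX o) else 0)
      (P : Measure (Obs 𝒳)) := by
    rw [eρQ]; exact iρ.add iΔ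
  rw [psi_eq_add hs iY iρ, psi_eq_add hs (h.integrable_iff.2 (h.integrable_mul iY))
    (h.integrable_iff.2 (h.integrable_mul iρQ)), h.integral_eq, h.integral_eq]
  have e1 : ∫ o, (if trtT o = t then outY o else 0) * (p o - 1) ∂(P : Measure (Obs 𝒳))
      = ∫ o, p o * (if trtT o = t then outY o else 0) ∂(P : Measure (Obs 𝒳))
        - ∫ o, (if trtT o = t then outY o else 0) ∂(P : Measure (Obs 𝒳)) := by
    rw [← integral_sub (h.integrable_mul iY) iY]
    exact integral_congr_ae (ae_of_all _ fun o => by ring)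
  have e2 : ∫ o, (if trtT o = 1 - t then tiltedMean P t γ s (covX o) else 0) * (p o - 1)
        ∂(P : Measure (Obs 𝒳))
      = ∫ o, p o * (if trtT o = 1 - t then tiltedMean P t γ s (covX o) else 0)
          ∂(P : Measure (Obs 𝒳))
        - ∫ o, (if trtT o = 1 - t then tiltedMean P t γ s (covX o) else 0)
          ∂(P : Measure (Obs 𝒳)) := by
    rw [← integral_sub (h.integrable_mul iρ) iρ]
    exact integral_congr_ae (ae_of_all _ fun o => by ring)
  have e3 : ∫ o, p o * (if trtT o = 1 - t then tiltedMean Q t γ s (covX o) else 0)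
        ∂(P : Measure (Obs 𝒳))
      = ∫ o, p o * (if trtT o = 1 - t then tiltedMean P t γ s (covX o) else 0)
          ∂(P : Measure (Obs 𝒳))
        + ∫ o, p o * (if trtT o = 1 - t then
          tiltedMean Q t γ s (covX o) - tiltedMean P t γ s (covX o) else 0)
          ∂(P : Measure (Obs 𝒳)) := by
    rw [← integral_add (h.integrable_mul iρ) (h.integrable_mul iΔ)]
    exact integral_congr_ae (ae_of_all _ fun o => by
      simp only
      rw [← mul_add]
      exact congrArg _ (congrFun eρQ o))
  have e4 : ∫ o, p o * (if trtT o = 1 - t then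
          tiltedMean Q t γ s (covX o) - tiltedMean P t γ s (covX o) else 0)
          ∂(P : Measure (Obs 𝒳))
      = ∫ x, propensity P (1 - t) x * (ratioMean P p (1 - t) (fun _ => 1) x
        * (tiltedMean Q t γ s x - tiltedMean P t γ s x)) ∂(lawX P) := by
    have hm : Measurable fun o : Obs 𝒳 =>
        p o * (tiltedMean Q t γ s (covX o) - tiltedMean P t γ s (covX o)) :=
      h.measurable.mul ((hρQ.comp measurable_covX).sub (hρ.comp measurable_covX))
    have hi := h.integrable_mul iΔ
    simp only [mul_ite, mul_zero] at hi ⊢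
    rw [integral_arm P (1 - t) hm hi, integral_armX]
    refine integral_congr_ae (ae_of_all _ fun x => ?_)
    simp only [covX, ratioMean, one_mul]
    rw [integral_mul_const]
  have e5 : ∫ o, (if trtT o = t then residual P t γ s o else 0)
          * residualFactor P p t γ s (covX o) * (p o - 1) ∂(P : Measure (Obs 𝒳))
      = ∫ x, propensity P t x * ∫ y, residual P t γ s (x, t, y)
          * residualFactor P p t γ s x * (p (x, t, y) - 1) ∂(condLawY P t x) ∂(lawX P) := by
    have hm : Measurable fun o : Obs 𝒳 =>
        residual P t γ s o * residualFactor P p t γ s (covX o) * (p o - 1) :=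
      ((measurable_residual P t γ hs).mul ((measurable_residualFactor P h.measurable t γ hs).comp
        measurable_covX)).mul (h.measurable.sub_const 1)
    have hi : Integrable (fun o => (if trtT o = t then residual P t γ s o else 0)
          * residualFactor P p t γ s (covX o) * (p o - 1)) (P : Measure (Obs 𝒳)) := by
      refine (iR.mul_bdd (c := C / c) ((measurable_residualFactor P h.measurable t γ hs).comp
        measurable_covX).aestronglyMeasurable ?_).mul_bdd (c := C + 1)
        (h.measurable.sub_const 1).aestronglyMeasurable (ae_of_all _ fun o => ?_)
      · filter_upwards [ae_covX hP.integrable_weight] with o ho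
        exact h.abs_residualFactor_le ho
      · rw [Real.norm_eq_abs, abs_le]
        constructor <;> linarith [h.nonneg o, h.upper o]
    simp only [ite_mul, zero_mul] at hi ⊢
    rw [integral_arm P t hm hi, integral_armX]
    rfl
  -- The -1 contributes nothing, as the weighted residual has conditional mean zero. What is left is
  -- `tiltedMean_sub`: π_t and the mean of w cancel, and the residual factor supplies the
  -- denominator and the mean of p on the other arm.
  have e6 : ∫ x, propensity P t x * ∫ y, residual P t γ s (x, t, y)
          * residualFactor P p t γ s x * (p (x, t, y) - 1) ∂(condLawY P t x) ∂(lawX P)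
      = ∫ x, propensity P (1 - t) x * (ratioMean P p (1 - t) (fun _ => 1) x
        * (tiltedMean Q t γ s x - tiltedMean P t γ s x)) ∂(lawX P) := by
    refine integral_congr_ae ?_
    filter_upwards [h.tiltedMean_sub hP, hP.positivity t, hP.integrable_weight,
      hP.integrable_mul_weight] with x hx hπ hw hyw
    have hi := integrable_weighted_residual hw hyw
    have hW := meanW_pos hw
    have hD := h.ratioMean_weight_pos hw
    have h1 : (fun y => residual P t γ s (x, t, y) * residualFactor P p t γ s x
        * (p (x, t, y) - 1)) = fun y =>
        propensity P (1 - t) x / propensity P t x / meanW P t γ s x * residualFactor P p t γ s x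
        * (weight γ s y * (y - tiltedMean P t γ s x) * p (x, t, y)
          - weight γ s y * (y - tiltedMean P t γ s x)) := by
      ext y
      simp only [residual, covX, outY]
      ring
    rw [h1, integral_const_mul, integral_sub (h.integrable_fiber_mul hi) hi,
      integral_weighted_residual hw hyw, sub_zero, hx, residualFactor]
    field_simp
  rw [e1, e2, e3, e4, e5, e6]
  ring

end HasBoundedRatio

end Expansion

/-! ### Limits of products of bounded and L²-convergent factors -/

section Limits

variable {α : Type*} [MeasurableSpace α] {μ : Measure α}

/-- Split q n = (q n - g) + g: Hölder's inequality and the uniform bound on B n kill the first part,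
and dominated convergence handles the second. -/
lemma tendsto_integral_mul_mul_of_tendsto_eLpNorm {f g : α → ℝ} (hf : MemLp f 2 μ)
    (hg : MemLp g 2 μ) {q : ℕ → α → ℝ} (hq : ∀ n, MemLp (q n) 2 μ)
    (hqg : Tendsto (fun n => eLpNorm (fun a => q n a - g a) 2 μ) atTop (𝓝 0))
    {B : ℕ → α → ℝ} (hB : ∀ n, AEStronglyMeasurable (B n) μ) {K : ℝ}
    (hBK : ∀ n, ∀ᵐ a ∂μ, |B n a| ≤ K) {b : ℝ}
    (hBb : ∀ᵐ a ∂μ, Tendsto (fun n => B n a) atTop (𝓝 b)) :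
    Tendsto (fun n => ∫ a, f a * B n a * q n a ∂μ) atTop (𝓝 (∫ a, f a * b * g a ∂μ)) := by
  have hfB : ∀ n, MemLp (fun a => f a * B n a) 2 μ := fun n => by
    refine MemLp.of_le_mul (c := K) hf (hf.1.mul (hB n)) ?_
    filter_upwards [hBK n] with a ha
    rw [norm_mul, mul_comm]
    exact mul_le_mul_of_nonneg_right ha (norm_nonneg _)
  have h1 : Tendsto (fun n => ∫ a, f a * B n a * (q n a - g a) ∂μ) atTop (𝓝 0) := by
    have hi : ∀ n, Integrable (fun a => f a * B n a * (q n a - g a)) μ := fun n =>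
      (hfB n).integrable_mul ((hq n).sub hg)
    have := tendsto_integral_of_L1' (μ := μ) (fun _ => (0 : ℝ)) aestronglyMeasurable_const
      (F := fun n a => f a * B n a * (q n a - g a)) (l := atTop) (Eventually.of_forall hi) ?_
    · simpa using this
    have hub : Tendsto (fun n => ENNReal.ofReal K * (eLpNorm f 2 μ
        * eLpNorm (fun a => q n a - g a) 2 μ)) atTop (𝓝 0) := by
      have h2 := ENNReal.Tendsto.const_mul (a := eLpNorm f 2 μ) hqg (Or.inr hf.2.ne)
      have h3 := ENNReal.Tendsto.const_mul (a := ENNReal.ofReal K) h2 (Or.inr ENNReal.ofReal_ne_top)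
      simpa using h3
    refine tendsto_of_tendsto_of_tendsto_of_le_of_le tendsto_const_nhds hub
      (fun n => zero_le) fun n => ?_
    have h4 : eLpNorm (fun a => f a * (q n a - g a)) 1 μ
        ≤ eLpNorm f 2 μ * eLpNorm (fun a => q n a - g a) 2 μ := by
      have h5 := eLpNorm_smul_le_mul_eLpNorm (p := 2) (q := 2) (r := 1) (μ := μ)
        (f := fun a => q n a - g a) (φ := f) ((hq n).sub hg).1 hf.1
      exact h5
    refine le_trans ?_ (mul_le_mul_right h4 _)
    refine eLpNorm_le_mul_eLpNorm_of_ae_le_mul ?_ 1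
    filter_upwards [hBK n] with a ha
    simp only [Pi.sub_apply, sub_zero, norm_mul]
    rw [mul_comm ‖f a‖, mul_assoc]
    exact mul_le_mul_of_nonneg_right ha (by positivity)
  have h2 : Tendsto (fun n => ∫ a, f a * B n a * g a ∂μ) atTop (𝓝 (∫ a, f a * b * g a ∂μ)) := by
    refine tendsto_integral_of_dominated_convergence (fun a => K * ‖f a * g a‖)
      (fun n => (hf.1.mul (hB n)).mul hg.1) ((hf.integrable_mul hg).norm.const_mul K)
      (fun n => ?_) ?_
    · filter_upwards [hBK n] with a ha
      have : ‖f a * B n a * g a‖ = |B n a| * ‖f a * g a‖ := by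
        simp only [norm_mul, Real.norm_eq_abs]; ring
      rw [this]
      exact mul_le_mul_of_nonneg_right ha (norm_nonneg _)
    · filter_upwards [hBb] with a ha
      exact (ha.const_mul _).mul_const _
  have h3 := h1.add h2
  rw [zero_add] at h3
  refine h3.congr fun n => ?_
  have hi : Integrable (fun a => f a * B n a * (q n a - g a)) μ :=
    (hfB n).integrable_mul ((hq n).sub hg)
  have hi' : Integrable (fun a => f a * B n a * g a) μ := (hfB n).integrable_mul hg
  rw [← integral_add hi hi']
  exact integral_congr_ae (ae_of_all _ fun a => by simp only; ring)

end Limits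

/-! ### Pathwise derivative along regular submodels -/

section Derivative

variable {𝒳 : Type*} [MeasurableSpace 𝒳] {t : Fin 2} {γ : ℝ} {s : ℝ → ℝ}
  {P : ProbabilityMeasure (Obs 𝒳)} {c C : ℝ}

/-- The Radon-Nikodym derivative, truncated to `[c, C]`. -/
noncomputable def truncRatio (P Q : ProbabilityMeasure (Obs 𝒳)) (c C : ℝ) (o : Obs 𝒳) : ℝ :=
  max c (min C ((Q : Measure (Obs 𝒳)).rnDeriv (P : Measure (Obs 𝒳)) o).toReal)

/-- Inequalities between measures on all sets give almost everywhere bounds on the density, so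
truncation alters only a null set. It is used to make the bounds hold at every point. -/
lemma truncRatio_ae_eq {Q : ProbabilityMeasure (Obs 𝒳)} {c C : ℝ≥0}
    (h1 : c • (P : Measure (Obs 𝒳)) ≤ (Q : Measure (Obs 𝒳)))
    (h2 : (Q : Measure (Obs 𝒳)) ≤ C • (P : Measure (Obs 𝒳))) :
    ∀ᵐ o ∂(P : Measure (Obs 𝒳)), ENNReal.ofReal (truncRatio P Q c C o)
      = (Q : Measure (Obs 𝒳)).rnDeriv (P : Measure (Obs 𝒳)) o := by
  have hac : (Q : Measure (Obs 𝒳)) ≪ (P : Measure (Obs 𝒳)) :=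
    (Measure.absolutelyContinuous_of_le h2).trans Measure.smul_absolutelyContinuous
  have hr := Measure.measurable_rnDeriv (Q : Measure (Obs 𝒳)) (P : Measure (Obs 𝒳))
  have hset : ∀ A, ∫⁻ o in A, (Q : Measure (Obs 𝒳)).rnDeriv (P : Measure (Obs 𝒳)) o
      ∂(P : Measure (Obs 𝒳)) = (Q : Measure (Obs 𝒳)) A := fun A =>
    Measure.setLIntegral_rnDeriv hac A
  have hlow : ∀ᵐ o ∂(P : Measure (Obs 𝒳)),
      (c : ℝ≥0∞) ≤ (Q : Measure (Obs 𝒳)).rnDeriv (P : Measure (Obs 𝒳)) o := by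
    refine ae_le_of_forall_setLIntegral_le_of_sigmaFinite measurable_const fun A hA _ => ?_
    rw [hset, setLIntegral_const]
    exact h1 A
  have hup : ∀ᵐ o ∂(P : Measure (Obs 𝒳)),
      (Q : Measure (Obs 𝒳)).rnDeriv (P : Measure (Obs 𝒳)) o ≤ (C : ℝ≥0∞) := by
    refine ae_le_of_forall_setLIntegral_le_of_sigmaFinite hr fun A hA _ => ?_
    rw [hset, setLIntegral_const]
    exact h2 A
  filter_upwards [hlow, hup] with o ho1 ho2
  have hne : (Q : Measure (Obs 𝒳)).rnDeriv (P : Measure (Obs 𝒳)) o ≠ ∞ :=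
    (ho2.trans_lt ENNReal.coe_lt_top).ne
  have h3 := ENNReal.toReal_mono hne ho1
  have h4 := ENNReal.toReal_mono ENNReal.coe_ne_top ho2
  simp only [ENNReal.coe_toReal] at h3 h4
  rw [truncRatio, min_eq_right h4, max_eq_right h3, ENNReal.ofReal_toReal hne]

lemma hasBoundedRatio_truncRatio {Q : ProbabilityMeasure (Obs 𝒳)} {c C : ℝ≥0} (hc : 0 < c)
    (h1 : c • (P : Measure (Obs 𝒳)) ≤ (Q : Measure (Obs 𝒳)))
    (h2 : (Q : Measure (Obs 𝒳)) ≤ C • (P : Measure (Obs 𝒳))) :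
    HasBoundedRatio P Q (truncRatio P Q c C) c C where
  pos := by exact_mod_cast hc
  measurable := measurable_const.max
    (measurable_const.min (Measure.measurable_rnDeriv _ _).ennreal_toReal)
  lower o := le_max_left _ _
  upper o := by
    -- Comparing total masses gives c ≤ C, without which the truncated ratio could exceed C.
    have h3 := (h1.trans h2) Set.univ
    simp only [Measure.smul_apply, measure_univ, ENNReal.smul_def, smul_eq_mul, mul_one] at h3
    refine max_le ?_ (min_le_left _ _)
    exact_mod_cast h3
  eq_withDensity := by
    have hac : (Q : Measure (Obs 𝒳)) ≪ (P : Measure (Obs 𝒳)) :=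
      (Measure.absolutelyContinuous_of_le h2).trans Measure.smul_absolutelyContinuous
    rw [withDensity_congr_ae (truncRatio_ae_eq h1 h2), Measure.withDensity_rnDeriv_eq _ _ hac]

lemma tendsto_ratioMean {p : ℕ → Obs 𝒳 → ℝ} {Q : ℕ → ProbabilityMeasure (Obs 𝒳)}
    (h : ∀ n, HasBoundedRatio P (Q n) (p n) c C) {x : 𝒳} {g : ℝ → ℝ}
    (hg : Integrable g (condLawY P t x))
    (hp : ∀ᵐ y ∂(condLawY P t x), Tendsto (fun n => p n (x, t, y)) atTop (𝓝 1)) :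
    Tendsto (fun n => ratioMean P (p n) t g x) atTop (𝓝 (condMean P t g x)) := by
  refine tendsto_integral_of_dominated_convergence (fun y => C * ‖g y‖)
    (fun n => ((h n).integrable_fiber_mul hg).aestronglyMeasurable) (hg.norm.const_mul C)
    (fun n => ae_of_all _ fun y => ?_) ?_
  · rw [norm_mul, mul_comm, Real.norm_of_nonneg ((h n).nonneg _)]
    exact mul_le_mul_of_nonneg_right ((h n).upper _) (norm_nonneg _)
  · filter_upwards [hp] with y hy
    simpa using hy.const_mul (g y)

/-- Dominated convergence within each arm; the factor mixes conditional means from both arms, so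
positivity of both propensities is used. -/
lemma tendsto_residualFactor (hP : IsRegularLaw t γ s P) {p : ℕ → Obs 𝒳 → ℝ}
    {Q : ℕ → ProbabilityMeasure (Obs 𝒳)} (h : ∀ n, HasBoundedRatio P (Q n) (p n) c C)
    (hp : ∀ᵐ o ∂(P : Measure (Obs 𝒳)), Tendsto (fun n => p n o) atTop (𝓝 1)) :
    ∀ᵐ x ∂(lawX P), Tendsto (fun n => residualFactor P (p n) t γ s x) atTop (𝓝 1) := by
  filter_upwards [hP.integrable_weight,
    (lawX_absolutelyContinuous_armX (hP.positivity t)).ae_le (ae_ae_of_ae_arm hp t),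
    (lawX_absolutelyContinuous_armX (hP.positivity (1 - t))).ae_le (ae_ae_of_ae_arm hp (1 - t))]
    with x hw h1 h2
  have hW := meanW_pos hw
  have h3 := (tendsto_const_nhds (x := meanW P t γ s x)).div (tendsto_ratioMean h hw h1) hW.ne'
  have h4 := tendsto_ratioMean h (integrable_const (1 : ℝ)) h2
  have h5 := h3.mul h4
  change Tendsto _ _ (𝓝 (meanW P t γ s x / meanW P t γ s x * _)) at h5
  simp only [condMean, integral_const, probReal_univ, smul_eq_mul, mul_one, div_self hW.ne'] at h5
  exact h5

/-- The two weighted terms are merged into one residual because only their difference is assumed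
square integrable. -/
lemma phi_eq (P : ProbabilityMeasure (Obs 𝒳)) (t : Fin 2) (γ : ℝ) (s : ℝ → ℝ) (o : Obs 𝒳) :
    phi t γ s P o = (if trtT o = t then outY o else 0)
      + (if trtT o = 1 - t then tiltedMean P t γ s (covX o) else 0)
      + (if trtT o = t then residual P t γ s o else 0) - psi t γ s P := by
  simp only [phi, tiltedMean, residual]
  split_ifs <;> ring

lemma tendsto_integral_score {p : ℕ → Obs 𝒳 → ℝ} {Q : ℕ → ProbabilityMeasure (Obs 𝒳)}
    {v : ℕ → ℝ} {g f : Obs 𝒳 → ℝ} (h : ∀ n, HasBoundedRatio P (Q n) (p n) c C)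
    (hg : MemLp g 2 (P : Measure (Obs 𝒳)))
    (hq : Tendsto (fun n => eLpNorm (fun o => (√(p n o) - 1) / v n - g o / 2) 2
      (P : Measure (Obs 𝒳))) atTop (𝓝 0))
    (hp : ∀ᵐ o ∂(P : Measure (Obs 𝒳)), Tendsto (fun n => p n o) atTop (𝓝 1))
    (hf : MemLp f 2 (P : Measure (Obs 𝒳))) {A : ℕ → Obs 𝒳 → ℝ} (hA : ∀ n, Measurable (A n))
    {K : ℝ} (hAK : ∀ n, ∀ᵐ o ∂(P : Measure (Obs 𝒳)), |A n o| ≤ K)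
    (hA1 : ∀ᵐ o ∂(P : Measure (Obs 𝒳)), Tendsto (fun n => A n o) atTop (𝓝 1)) :
    Tendsto (fun n => (v n)⁻¹ * ∫ o, f o * A n o * (p n o - 1) ∂(P : Measure (Obs 𝒳))) atTop
      (𝓝 (∫ o, f o * g o ∂(P : Measure (Obs 𝒳)))) := by
  have hsq : ∀ n, Measurable fun o => √(p n o) := fun n => (h n).measurable.sqrt
  have hqm : ∀ n, MemLp (fun o => (√(p n o) - 1) / v n) 2 (P : Measure (Obs 𝒳)) := fun n => by
    refine MemLp.of_bound (((hsq n).sub_const 1).div_const _).aestronglyMeasurable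
      ((√C + 1) / |v n|) (ae_of_all _ fun o => ?_)
    rw [norm_div, Real.norm_eq_abs, Real.norm_eq_abs]
    refine div_le_div_of_nonneg_right ?_ (abs_nonneg _)
    have h1 := Real.sqrt_le_sqrt ((h n).upper o)
    have h2 := Real.sqrt_nonneg (p n o)
    rw [abs_le]
    constructor <;> linarith
  have key := tendsto_integral_mul_mul_of_tendsto_eLpNorm hf (hg.mul_const (1 / 2)) hqm
    (by simpa [div_eq_mul_inv] using hq)
    -- The limit 2 is 1 · (√1 + 1); it cancels the 1/2 in the quadratic-mean limit g/2.
    (B := fun n o => A n o * (√(p n o) + 1)) (K := K * (√C + 1)) (b := 2)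
    (fun n => ((hA n).mul ((hsq n).add_const 1)).aestronglyMeasurable) (fun n => ?_) ?_
  · have hlim : ∫ o, f o * 2 * (g o * (1 / 2)) ∂(P : Measure (Obs 𝒳))
        = ∫ o, f o * g o ∂(P : Measure (Obs 𝒳)) :=
      integral_congr_ae (ae_of_all _ fun o => by simp only; ring)
    rw [hlim] at key
    refine key.congr fun n => ?_
    rw [← integral_const_mul]
    refine integral_congr_ae (ae_of_all _ fun o => ?_)
    have h3 := Real.mul_self_sqrt ((h n).nonneg o)
    have h4 : p n o - 1 = (√(p n o) + 1) * (√(p n o) - 1) := by linear_combination -h3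
    simp only [h4]
    rw [div_eq_inv_mul]
    ring
  · filter_upwards [hAK n] with o ho
    rw [abs_mul]
    refine mul_le_mul ho ?_ (abs_nonneg _) ((abs_nonneg _).trans ho)
    rw [abs_of_nonneg (by positivity)]
    gcongr
    exact (h n).upper o
  · filter_upwards [hA1, hp] with o h1 h2
    have h5 := h1.mul ((h2.sqrt).add_const 1)
    norm_num at h5
    exact h5

/-- L² convergence of (√p - 1)/v implies almost everywhere convergence along a subsequence;
multiplying by v → 0 forces √p → 1. -/
lemma exists_subseq_tendsto_ratio {p : ℕ → Obs 𝒳 → ℝ} {Q : ℕ → ProbabilityMeasure (Obs 𝒳)}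
    {v : ℕ → ℝ} {g : Obs 𝒳 → ℝ} (h : ∀ n, HasBoundedRatio P (Q n) (p n) c C)
    (hv : ∀ n, v n ≠ 0) (hv0 : Tendsto v atTop (𝓝 0)) (hg : MemLp g 2 (P : Measure (Obs 𝒳)))
    (hq : Tendsto (fun n => eLpNorm (fun o => (√(p n o) - 1) / v n - g o / 2) 2
      (P : Measure (Obs 𝒳))) atTop (𝓝 0)) :
    ∃ ns : ℕ → ℕ, StrictMono ns ∧
      ∀ᵐ o ∂(P : Measure (Obs 𝒳)), Tendsto (fun n => p (ns n) o) atTop (𝓝 1) := by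
  have hm : TendstoInMeasure (P : Measure (Obs 𝒳)) (fun n o => (√(p n o) - 1) / v n) atTop
      (fun o => g o / 2) := by
    refine tendstoInMeasure_of_tendsto_eLpNorm two_ne_zero (fun n => ?_) ?_ hq
    · exact (((h n).measurable.sqrt.sub_const 1).div_const _).aestronglyMeasurable
    · simpa only [div_eq_mul_inv] using hg.1.mul_const _
  obtain ⟨ns, hns, hae⟩ := hm.exists_seq_tendsto_ae
  refine ⟨ns, hns, ?_⟩
  filter_upwards [hae] with o ho
  have h1 := ((hv0.comp hns.tendsto_atTop).mul ho).add_const 1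
  rw [zero_mul, zero_add] at h1
  have h2 := h1.mul h1
  rw [one_mul] at h2
  refine h2.congr fun n => ?_
  simp only [Function.comp_apply]
  rw [mul_div_cancel₀ _ (hv _), sub_add_cancel, Real.mul_self_sqrt ((h _).nonneg o)]

lemma memLp_phi (hP : IsRegularLaw t γ s P) :
    MemLp (phi t γ s P) 2 (P : Measure (Obs 𝒳)) := by
  have h := ((hP.memLp_outcome.add hP.memLp_tiltedMean).add hP.memLp_residual).sub
    (memLp_const (psi t γ s P))
  exact h.ae_eq (ae_of_all _ fun o => (phi_eq P t γ s o).symm)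

lemma integral_residual (hs : Measurable s) (hP : IsRegularLaw t γ s P) :
    ∫ o, (if trtT o = t then residual P t γ s o else 0) ∂(P : Measure (Obs 𝒳)) = 0 := by
  rw [integral_arm P t (measurable_residual P t γ hs) (hP.memLp_residual.integrable one_le_two)]
  refine integral_eq_zero_of_ae ?_
  filter_upwards [(Measure.absolutelyContinuous_of_le (armX_le_lawX P t)).ae_le
    hP.integrable_weight, (Measure.absolutelyContinuous_of_le (armX_le_lawX P t)).ae_le
    hP.integrable_mul_weight] with x hw hyw
  have h1 : (fun y => residual P t γ s (x, t, y)) = fun y =>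
      propensity P (1 - t) x / propensity P t x / meanW P t γ s x
      * (weight γ s y * (y - tiltedMean P t γ s x)) := by
    ext y
    simp only [residual, covX, outY]
    ring
  rw [h1, integral_const_mul, integral_weighted_residual hw hyw, mul_zero, Pi.zero_apply]

lemma integral_phi (hs : Measurable s) (hP : IsRegularLaw t γ s P) :
    ∫ o, phi t γ s P o ∂(P : Measure (Obs 𝒳)) = 0 := by
  have iY := hP.memLp_outcome.integrable one_le_two
  have iρ : Integrable (fun o => if trtT o = 1 - t then tiltedMean P t γ s (covX o) else 0)
      (P : Measure (Obs 𝒳)) := hP.memLp_tiltedMean.integrable one_le_two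
  have iR : Integrable (fun o => if trtT o = t then residual P t γ s o else 0)
      (P : Measure (Obs 𝒳)) := hP.memLp_residual.integrable one_le_two
  have iYρ : Integrable (fun o => (if trtT o = t then outY o else 0)
      + (if trtT o = 1 - t then tiltedMean P t γ s (covX o) else 0))
      (P : Measure (Obs 𝒳)) := iY.add iρ
  have iYρR : Integrable (fun o => (if trtT o = t then outY o else 0)
      + (if trtT o = 1 - t then tiltedMean P t γ s (covX o) else 0)
      + (if trtT o = t then residual P t γ s o else 0)) (P : Measure (Obs 𝒳)) := iYρ.add iR
  simp only [phi_eq]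
  rw [integral_sub iYρR (integrable_const _), integral_add iYρ iR, integral_add iY iρ,
    integral_residual hs hP, psi_eq_add hs iY iρ]
  simp

lemma exists_subseq_tendsto_slope (hs : Measurable s) (hP : IsRegularLaw t γ s P)
    {p : ℕ → Obs 𝒳 → ℝ} {Q : ℕ → ProbabilityMeasure (Obs 𝒳)}
    {v : ℕ → ℝ} {g : Obs 𝒳 → ℝ} (h : ∀ n, HasBoundedRatio P (Q n) (p n) c C)
    (hv : ∀ n, v n ≠ 0) (hv0 : Tendsto v atTop (𝓝 0)) (hg : MemLp g 2 (P : Measure (Obs 𝒳)))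
    (hq : Tendsto (fun n => eLpNorm (fun o => (√(p n o) - 1) / v n - g o / 2) 2
      (P : Measure (Obs 𝒳))) atTop (𝓝 0)) :
    ∃ ns : ℕ → ℕ, Tendsto (fun n => (v (ns n))⁻¹ * (psi t γ s (Q (ns n)) - psi t γ s P)) atTop
      (𝓝 (∫ o, phi t γ s P o * g o ∂(P : Measure (Obs 𝒳)))) := by
  obtain ⟨ns, hns, hp⟩ := exists_subseq_tendsto_ratio h hv hv0 hg hq
  refine ⟨ns, ?_⟩
  have h' := fun n => h (ns n)
  have hq' := hq.comp hns.tendsto_atTop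
  have lim := fun (f : Obs 𝒳 → ℝ) (hf : MemLp f 2 (P : Measure (Obs 𝒳))) =>
    tendsto_integral_score h' hg hq' hp hf (A := fun _ _ => 1) (K := 1)
      (fun _ => measurable_const) (fun _ => ae_of_all _ fun _ => by simp)
      (ae_of_all _ fun _ => tendsto_const_nhds)
  simp only [mul_one] at lim
  have l1 := lim _ hP.memLp_outcome
  have l2 := lim _ hP.memLp_tiltedMean
  have l3 := tendsto_integral_score h' hg hq' hp hP.memLp_residual
    (A := fun n o => residualFactor P (p (ns n)) t γ s (covX o)) (K := C / c)
    (fun n => (measurable_residualFactor P (h' n).measurable t γ hs).comp measurable_covX)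
    (fun n => by
      filter_upwards [ae_covX hP.integrable_weight] with o ho
      exact (h' n).abs_residualFactor_le ho)
    (ae_covX (tendsto_residualFactor hP h' hp))
  have l4 := lim (fun _ => 1) (memLp_const 1)
  -- Scores have mean zero: take f = 1 in the limit and use that each p integrates to 1. This
  -- removes the constant ψ_t(P) from the pairing of φ_t with g.
  have hmean : ∫ o, g o ∂(P : Measure (Obs 𝒳)) = 0 := by
    simp only [one_mul] at l4
    refine tendsto_nhds_unique l4 (tendsto_const_nhds.congr fun n => ?_)
    have e1 := (h' n).integral_eq (fun _ => 1)
    have e2 : Integrable (p (ns n)) (P : Measure (Obs 𝒳)) := by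
      simpa using (h' n).integrable_mul (integrable_const (1 : ℝ))
    simp only [mul_one, integral_const, probReal_univ, smul_eq_mul] at e1
    rw [integral_sub e2 (integrable_const _), ← e1]
    simp
  have l5 := (l1.add l2).add l3
  have hlim : ∫ o, phi t γ s P o * g o ∂(P : Measure (Obs 𝒳))
      = ∫ o, (if trtT o = t then outY o else 0) * g o ∂(P : Measure (Obs 𝒳))
        + ∫ o, (if trtT o = 1 - t then tiltedMean P t γ s (covX o) else 0) * g o
          ∂(P : Measure (Obs 𝒳))
        + ∫ o, (if trtT o = t then residual P t γ s o else 0) * g o ∂(P : Measure (Obs 𝒳)) := by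
    have i1 : Integrable (fun o => (if trtT o = t then outY o else 0) * g o)
      (P : Measure (Obs 𝒳)) := hP.memLp_outcome.integrable_mul hg
    have i2 : Integrable (fun o =>
        (if trtT o = 1 - t then tiltedMean P t γ s (covX o) else 0) * g o)
      (P : Measure (Obs 𝒳)) := hP.memLp_tiltedMean.integrable_mul hg
    have i3 : Integrable (fun o => (if trtT o = t then residual P t γ s o else 0) * g o)
      (P : Measure (Obs 𝒳)) := hP.memLp_residual.integrable_mul hg
    have i4 : Integrable (fun o => psi t γ s P * g o) (P : Measure (Obs 𝒳)) :=
      (hg.integrable one_le_two).const_mul _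
    have i12 : Integrable (fun o => (if trtT o = t then outY o else 0) * g o
        + (if trtT o = 1 - t then tiltedMean P t γ s (covX o) else 0) * g o)
      (P : Measure (Obs 𝒳)) := i1.add i2
    have i123 : Integrable (fun o => (if trtT o = t then outY o else 0) * g o
        + (if trtT o = 1 - t then tiltedMean P t γ s (covX o) else 0) * g o
        + (if trtT o = t then residual P t γ s o else 0) * g o)
      (P : Measure (Obs 𝒳)) := i12.add i3
    simp only [phi_eq, sub_mul, add_mul]
    rw [integral_sub i123 i4, integral_add i12 i3, integral_add i1 i2, integral_const_mul, hmean,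
      mul_zero, sub_zero]
  rw [hlim]
  refine l5.congr fun n => ?_
  rw [(h' n).psi_sub hs hP, mul_add, mul_add]
  rfl

lemma hasDerivAt_psi (hs : Measurable s) (hP : IsRegularLaw t γ s P)
    {path : ℝ → ProbabilityMeasure (Obs 𝒳)} {g : Obs 𝒳 → ℝ} (h : IsRegularSubmodel P path g) :
    HasDerivAt (fun θ => psi t γ s (path θ)) (∫ o, phi t γ s P o * g o ∂(P : Measure (Obs 𝒳)))
      0 := by
  obtain ⟨c, C, hc, hb⟩ := h.bounded_ratio
  rw [hasDerivAt_iff_tendsto_slope_zero]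
  refine tendsto_of_subseq_tendsto fun u hu => ?_
  obtain ⟨hu0, hu1⟩ := tendsto_nhdsWithin_iff.1 hu
  -- The ratio bounds hold only near 0, so the sequence is shifted until they hold for every index.
  obtain ⟨N, hN⟩ := eventually_atTop.1 ((hu0.eventually hb).and hu1)
  set v : ℕ → ℝ := fun n => u (n + N) with hv
  have hvN := fun n => hN (n + N) (Nat.le_add_left N n)
  have hq := h.quadratic_mean.comp (hu.comp (tendsto_add_atTop_nat N))
  obtain ⟨ns, hns⟩ := exists_subseq_tendsto_slope hs hP
    (Q := fun n => path (v n)) (v := v) (g := g)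
    (fun n => hasBoundedRatio_truncRatio hc (hvN n).1.1 (hvN n).1.2)
    (fun n => (hvN n).2) (hu0.comp (tendsto_add_atTop_nat N)) h.memLp_score (hq.congr fun n => by
      refine eLpNorm_congr_ae ?_
      filter_upwards [truncRatio_ae_eq (hvN n).1.1 (hvN n).1.2] with o ho
      have h1 : (((path (v n) : Measure (Obs 𝒳)).rnDeriv (P : Measure (Obs 𝒳)) o)).toReal
          = truncRatio P (path (v n)) c C o := by
        rw [← ho, ENNReal.toReal_ofReal]
        exact c.coe_nonneg.trans (le_max_left _ _)
      simp only [Function.comp_apply]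
      rw [← h1])
  refine ⟨fun n => ns n + N, ?_⟩
  simp only [zero_add, h.path_zero, smul_eq_mul]
  exact hns

end Derivative

/-! ### The nonparametric tangent space and uniqueness of the gradient -/

section TangentSpace

variable {O : Type*} [MeasurableSpace O] {P : ProbabilityMeasure O}

open Classical in
/-- The linear perturbation `(1 + θ g) P`, wherever it is a probability measure. -/
noncomputable def linearPath (P : ProbabilityMeasure O) (g : O → ℝ) (θ : ℝ) :
    ProbabilityMeasure O :=
  if h : IsProbabilityMeasure
      ((P : Measure O).withDensity fun o => ENNReal.ofReal (1 + θ * g o)) then ⟨_, h⟩ else P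

/-- With r = √(1 + u), the error is -(r - 1)²/2 and u = (r - 1)(r + 1), where r + 1 ≥ 1. -/
lemma abs_sqrt_one_add_sub_le {u : ℝ} (hu : |u| ≤ 1 / 2) : |√(1 + u) - 1 - u / 2| ≤ u ^ 2 / 2 := by
  have h1 : -(1 / 2) ≤ u := (abs_le.1 hu).1
  have h2 : √(1 + u) ^ 2 = 1 + u := Real.sq_sqrt (by linarith)
  have h3 : 0 ≤ √(1 + u) := Real.sqrt_nonneg _
  set r := √(1 + u)
  have h4 : r - 1 - u / 2 = -((r - 1) ^ 2 / 2) := by linear_combination h2 / 2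
  have h5 : u = (r - 1) * (r + 1) := by linear_combination -h2
  rw [h4, abs_neg, abs_of_nonneg (by positivity), h5]
  have h6 : (r - 1) ^ 2 * 1 ≤ (r - 1) ^ 2 * (r + 1) ^ 2 :=
    mul_le_mul_of_nonneg_left (by nlinarith) (sq_nonneg _)
  rw [mul_pow]
  linarith

lemma linearPath_eq {g : O → ℝ} (hg : Measurable g) {K : ℝ} (hK : ∀ o, |g o| ≤ K)
    (h0 : ∫ o, g o ∂(P : Measure O) = 0) {θ : ℝ} (hθ : |θ| * K ≤ 1 / 2) :
    (linearPath P g θ : Measure O)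
      = (P : Measure O).withDensity fun o => ENNReal.ofReal (1 + θ * g o) := by
  have hi : Integrable g (P : Measure O) :=
    Integrable.of_bound hg.aestronglyMeasurable K (ae_of_all _ hK)
  have hθg : ∀ o, |θ * g o| ≤ 1 / 2 := fun o => by
    rw [abs_mul]
    exact (mul_le_mul_of_nonneg_left (hK o) (abs_nonneg _)).trans hθ
  have h : IsProbabilityMeasure
      ((P : Measure O).withDensity fun o => ENNReal.ofReal (1 + θ * g o)) := by
    have hi1 : Integrable (fun o => 1 + θ * g o) (P : Measure O) :=
      (integrable_const _).add (hi.const_mul θ)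
    refine ⟨?_⟩
    rw [withDensity_apply _ MeasurableSet.univ, Measure.restrict_univ,
      ← ofReal_integral_eq_lintegral_ofReal hi1
        (ae_of_all _ fun o => by
          simp only [Pi.zero_apply]; linarith [(abs_le.1 (hθg o)).1]),
      integral_add (integrable_const _) (hi.const_mul θ), integral_const_mul, h0]
    simp
  have e : linearPath P g θ = ⟨_, h⟩ := dif_pos h
  rw [e]
  rfl

/-- Once |θ| K ≤ 1/2 the density 1 + θ g lies in [1/2, 3/2], and the expansion of the square root
leaves a quadratic-mean error of at most |θ| K²/2. -/
lemma isRegularSubmodel_linearPath {g : O → ℝ} (hg : Measurable g) {K : ℝ} (hK : ∀ o, |g o| ≤ K)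
    (h0 : ∫ o, g o ∂(P : Measure O) = 0) : IsRegularSubmodel P (linearPath P g) g := by
  have hev : ∀ᶠ θ : ℝ in 𝓝 0, |θ| * K ≤ 1 / 2 := by
    have : Tendsto (fun θ : ℝ => |θ| * K) (𝓝 0) (𝓝 (|0| * K)) :=
      (continuous_abs.mul continuous_const).tendsto 0
    rw [abs_zero, zero_mul] at this
    exact this.eventually_le_const (by norm_num)
  have hθg : ∀ θ : ℝ, |θ| * K ≤ 1 / 2 → ∀ o, |θ * g o| ≤ 1 / 2 := fun θ hθ o => by
    rw [abs_mul]
    exact (mul_le_mul_of_nonneg_left (hK o) (abs_nonneg _)).trans hθ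
  refine ⟨?_, MemLp.of_bound hg.aestronglyMeasurable K (ae_of_all _ hK), ?_, ?_⟩
  · apply Subtype.ext
    have := linearPath_eq (P := P) hg hK h0 (θ := 0) (by simp)
    refine this.trans ?_
    simp
  · refine ⟨1 / 2, 3 / 2, by norm_num, hev.mono fun θ hθ => ?_⟩
    rw [linearPath_eq hg hK h0 hθ]
    have e : ∀ k : ℝ≥0, k • (P : Measure O) = (P : Measure O).withDensity fun _ => (k : ℝ≥0∞) := by
      intro k
      rw [withDensity_const]
      rfl
    rw [e, e]
    constructor
    · refine withDensity_mono (ae_of_all _ fun o => ?_)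
      rw [← ENNReal.ofReal_coe_nnreal]
      refine ENNReal.ofReal_le_ofReal ?_
      have := (abs_le.1 (hθg θ hθ o)).1
      push_cast
      linarith
    · refine withDensity_mono (ae_of_all _ fun o => ?_)
      rw [← ENNReal.ofReal_coe_nnreal]
      refine ENNReal.ofReal_le_ofReal ?_
      have := (abs_le.1 (hθg θ hθ o)).2
      push_cast
      linarith
  · have hub : Tendsto (fun θ : ℝ => ENNReal.ofReal (|θ| * (K ^ 2 / 2))) (𝓝[≠] 0) (𝓝 0) := by
      have : Tendsto (fun θ : ℝ => |θ| * (K ^ 2 / 2)) (𝓝 0) (𝓝 (|0| * (K ^ 2 / 2))) :=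
        (continuous_abs.mul continuous_const).tendsto 0
      rw [abs_zero, zero_mul] at this
      have h2 := (ENNReal.continuous_ofReal.tendsto 0).comp (this.mono_left (nhdsWithin_le_nhds (s := {0}ᶜ)))
      rwa [ENNReal.ofReal_zero] at h2
    refine tendsto_of_tendsto_of_tendsto_of_le_of_le' tendsto_const_nhds hub
      (Eventually.of_forall fun θ => zero_le) ?_
    filter_upwards [hev.filter_mono nhdsWithin_le_nhds, self_mem_nhdsWithin] with θ hθ hθ0
    have hθ0 : θ ≠ 0 := hθ0
    refine (eLpNorm_le_of_ae_bound (C := |θ| * (K ^ 2 / 2)) ?_).trans (by simp)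
    rw [linearPath_eq hg hK h0 hθ]
    filter_upwards [Measure.rnDeriv_withDensity (P : Measure O)
      ((hg.const_mul θ).const_add 1).ennreal_ofReal] with o ho
    have hu := hθg θ hθ o
    rw [ho, ENNReal.toReal_ofReal (by linarith [(abs_le.1 hu).1]), Real.norm_eq_abs]
    have e : (√(1 + θ * g o) - 1) / θ - g o / 2
        = (√(1 + θ * g o) - 1 - θ * g o / 2) / θ := by field_simp
    rw [e, abs_div, div_le_iff₀ (abs_pos.2 hθ0)]
    refine (abs_sqrt_one_add_sub_le hu).trans ?_
    have h3 : g o ^ 2 ≤ K ^ 2 := by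
      rw [← sq_abs]
      exact pow_le_pow_left₀ (abs_nonneg _) (hK o) 2
    have h4 : |θ| * (K ^ 2 / 2) * |θ| = θ ^ 2 * K ^ 2 / 2 := by
      rw [← sq_abs θ]; ring
    rw [h4, mul_pow]
    have := mul_le_mul_of_nonneg_left h3 (sq_nonneg θ)
    linarith

/-- A square-integrable function orthogonal to every score is almost everywhere constant. -/
lemma ae_eq_integral_of_orthogonal_scores {v : O → ℝ} (hv : MemLp v 2 (P : Measure O))
    (h : ∀ (path : ℝ → ProbabilityMeasure O) (g : O → ℝ), IsRegularSubmodel P path g →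
      ∫ o, v o * g o ∂(P : Measure O) = 0) :
    v =ᵐ[(P : Measure O)] fun _ => ∫ o, v o ∂(P : Measure O) := by
  set m := ∫ o, v o ∂(P : Measure O) with hm
  set v₀ := hv.1.mk v with hv₀
  have hv₀m : Measurable v₀ := hv.1.stronglyMeasurable_mk.measurable
  have hvv₀ : v =ᵐ[(P : Measure O)] v₀ := hv.1.ae_eq_mk
  -- A bounded test function with the sign of v - m, so that (v - m) b ≥ 0 vanishes only where v =
  -- m. After centring it is a score.
  set b : O → ℝ := fun o => max (-1) (min 1 (v₀ o - m)) with hb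
  have hbm : Measurable b := measurable_const.max (measurable_const.min (hv₀m.sub_const m))
  have hb1 : ∀ o, |b o| ≤ 1 := fun o =>
    abs_le.2 ⟨le_max_left _ _, max_le (by norm_num) (min_le_left _ _)⟩
  have hbi : Integrable b (P : Measure O) :=
    Integrable.of_bound hbm.aestronglyMeasurable 1 (ae_of_all _ hb1)
  set a := ∫ o, b o ∂(P : Measure O) with ha
  have hreg := isRegularSubmodel_linearPath (P := P) (g := fun o => b o - a) (hbm.sub_const a)
    (K := 1 + |a|) (fun o => (abs_sub _ _).trans (by gcongr; exact hb1 o))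
    (by rw [integral_sub hbi (integrable_const _)]; simp [ha])
  have h1 := h _ _ hreg
  have hvi : Integrable v (P : Measure O) := hv.integrable one_le_two
  have hvb : Integrable (fun o => v o * b o) (P : Measure O) :=
    hvi.mul_bdd hbm.aestronglyMeasurable (ae_of_all _ hb1)
  -- The centring moves from b to v: E[v (b - E b)] = E[(v - E v) b].
  have h2 : ∫ o, (v o - m) * b o ∂(P : Measure O) = 0 := by
    simp only [mul_sub, sub_mul] at h1 ⊢
    rw [integral_sub hvb (hvi.mul_const _), integral_mul_const] at h1
    rw [integral_sub hvb (hbi.const_mul _), integral_const_mul]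
    exact h1
  have hpos : ∀ x : ℝ, 0 ≤ x * max (-1) (min 1 x) := by
    intro x
    rcases le_total 0 x with hx | hx
    · exact mul_nonneg hx (le_max_of_le_right (le_min zero_le_one hx))
    · exact mul_nonneg_of_nonpos_of_nonpos hx
        (max_le (by norm_num) ((min_le_right _ _).trans hx))
  have h3 : 0 ≤ᵐ[(P : Measure O)] fun o => (v o - m) * b o := by
    filter_upwards [hvv₀] with o ho
    simp only [Pi.zero_apply, hb, ← ho]
    exact hpos _
  have hi : Integrable (fun o => (v o - m) * b o) (P : Measure O) := by
    simp only [sub_mul]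
    exact hvb.sub (hbi.const_mul _)
  have h4 := (integral_eq_zero_iff_of_nonneg_ae h3 hi).1 h2
  filter_upwards [h4, hvv₀] with o ho ho'
  simp only [Pi.zero_apply, hb, ← ho', mul_eq_zero] at ho
  rcases ho with ho | ho
  · linarith
  · rcases lt_trichotomy (v o - m) 0 with hlt | heq | hgt
    · have : max (-1) (min 1 (v o - m)) < 0 :=
        max_lt (by norm_num) ((min_le_right _ _).trans_lt hlt)
      linarith
    · linarith
    · have : 0 < max (-1) (min 1 (v o - m)) := lt_max_of_lt_right (lt_min zero_lt_one hgt)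
      linarith

/-- The tangent space of the nonparametric model contains every mean-zero square-integrable
function. -/
lemma mem_tangentSpace_of_integral_eq_zero {φ : O → ℝ} (hφ : MemLp φ 2 (P : Measure O))
    (h0 : ∫ o, φ o ∂(P : Measure O) = 0) : hφ.toLp φ ∈ tangentSpace P := by
  -- The closed span is the double orthogonal complement; vectors orthogonal to all scores are
  -- constants, and these are orthogonal to mean-zero functions.
  rw [tangentSpace, ← Submodule.orthogonal_orthogonal_eq_closure, Submodule.mem_orthogonal]
  intro v hv
  have h1 : v =ᵐ[(P : Measure O)] fun _ => ∫ o, v o ∂(P : Measure O) := by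
    refine ae_eq_integral_of_orthogonal_scores (Lp.memLp v) fun path g hg => ?_
    have h2 := (Submodule.mem_orthogonal' _ _).1 hv (hg.memLp_score.toLp g)
      (Submodule.subset_span ⟨path, g, hg, hg.memLp_score.coeFn_toLp⟩)
    rw [L2.inner_def] at h2
    rw [← h2]
    refine integral_congr_ae ?_
    filter_upwards [hg.memLp_score.coeFn_toLp] with o ho
    rw [ho]
    simp [mul_comm]
  rw [L2.inner_def]
  calc _ = ∫ o, (∫ o, v o ∂(P : Measure O)) * φ o ∂(P : Measure O) := by
        refine integral_congr_ae ?_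
        filter_upwards [h1, hφ.coeFn_toLp] with o ho ho'
        rw [ho', ← ho]
        simp [mul_comm]
    _ = 0 := by rw [integral_const_mul, h0, mul_zero]

/-- Derivatives are unique, so the difference of two gradients is orthogonal to every score, hence
constant, and its mean is zero. -/
lemma IsInfluenceFunction.ae_eq {Ψ : ProbabilityMeasure O → ℝ} {φ φ' : O → ℝ}
    (h' : IsInfluenceFunction Ψ P φ') (h : IsInfluenceFunction Ψ P φ) :
    φ' =ᵐ[(P : Measure O)] φ := by
  have h1 := ae_eq_integral_of_orthogonal_scores (h'.memLp.sub h.memLp) fun path g hg => by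
    have h2 := (h'.hasDerivAt path g hg).unique (h.hasDerivAt path g hg)
    have i1 : Integrable (fun o => φ' o * g o) (P : Measure O) :=
      h'.memLp.integrable_mul hg.memLp_score
    have i2 : Integrable (fun o => φ o * g o) (P : Measure O) :=
      h.memLp.integrable_mul hg.memLp_score
    simp only [Pi.sub_apply, sub_mul]
    rw [integral_sub i1 i2, h2, sub_self]
  filter_upwards [h1] with o ho
  simp only [Pi.sub_apply] at ho
  rw [integral_sub (h'.memLp.integrable one_le_two) (h.memLp.integrable one_le_two),
    h'.mean_zero, h.mean_zero, sub_self] at ho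
  linarith

end TangentSpace

/-! ### Identification of the mean potential outcome -/

section Identification

variable {𝒳 : Type*} [MeasurableSpace 𝒳] {Ω : Type*} [MeasurableSpace Ω] {t : Fin 2} {γ : ℝ}
  {s : ℝ → ℝ} {P Q : ProbabilityMeasure (Obs 𝒳)} {μ : Measure Ω} {X : Ω → 𝒳} {T : Ω → Fin 2}
  {Y : Ω → ℝ}

lemma armX_apply_of_map (hX : Measurable X) (hT : Measurable T) (hY : Measurable Y)
    (h : μ.map (fun ω => (X ω, T ω, Y ω)) = (Q : Measure (Obs 𝒳))) (t' : Fin 2) {A : Set 𝒳}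
    (hA : MeasurableSet A) : armX Q t' A = μ (X ⁻¹' A ∩ T ⁻¹' {t'}) := by
  rw [armX, Measure.map_apply measurable_covX hA, Measure.restrict_apply (measurable_covX hA), ← h,
    Measure.map_apply (by fun_prop) ((measurable_covX hA).inter (measurableSet_trt t'))]
  rfl

lemma armXY_apply_of_map (hX : Measurable X) (hT : Measurable T) (hY : Measurable Y)
    (h : μ.map (fun ω => (X ω, T ω, Y ω)) = (Q : Measure (Obs 𝒳))) (t' : Fin 2)
    {A : Set (𝒳 × ℝ)} (hA : MeasurableSet A) :
    armXY Q t' A = μ ((fun ω => (X ω, Y ω)) ⁻¹' A ∩ T ⁻¹' {t'}) := by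
  have hm : Measurable fun o : Obs 𝒳 => (covX o, outY o) := by fun_prop
  rw [armXY, Measure.map_apply hm hA, Measure.restrict_apply (hm hA), ← h,
    Measure.map_apply (by fun_prop) ((hm hA).inter (measurableSet_trt t'))]
  rfl

/-- Valid at every x and not just almost everywhere: the chosen version of the conditional
distribution depends only on the joint law. -/
lemma condLawY_of_map [IsFiniteMeasure μ] (hX : Measurable X) (hT : Measurable T)
    (hY : Measurable Y)
    (h : μ.map (fun ω => (X ω, T ω, Y ω)) = (Q : Measure (Obs 𝒳))) (t' : Fin 2) (x : 𝒳) :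
    condLawY Q t' x = condDistrib Y (fun ω => (X ω, T ω)) μ (x, t') := by
  have e : (Q : Measure (Obs 𝒳)).map (fun o => ((covX o, trtT o), outY o))
      = μ.map fun ω => ((X ω, T ω), Y ω) := by
    rw [← h, Measure.map_map (by fun_prop) (by fun_prop)]
    rfl
  have hc : ∀ (ρ ρ' : Measure ((𝒳 × Fin 2) × ℝ)) [IsFiniteMeasure ρ] [IsFiniteMeasure ρ'],
      ρ = ρ' → ρ.condKernel = ρ'.condKernel := by
    intro ρ ρ' _ _ hρ
    subst hρ
    rfl
  rw [condLawY, condDistrib, condDistrib]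
  exact DFunLike.congr_fun (hc _ _ e) _

lemma tilted_integrable_id {x : 𝒳} (hw : Integrable (weight γ s) (condLawY P t x))
    (hyw : Integrable (fun y => y * weight γ s y) (condLawY P t x)) :
    Integrable (fun y => y) ((condLawY P t x).tilted fun y => γ * s y) := by
  rw [integrable_tilted_iff hw]
  refine hyw.congr (ae_of_all _ fun y => ?_)
  simp only [weight, smul_eq_mul, mul_comm]

lemma integral_id_tilted (P : ProbabilityMeasure (Obs 𝒳)) (t : Fin 2) (γ : ℝ) (s : ℝ → ℝ)
    (x : 𝒳) :
    ∫ y, y ∂((condLawY P t x).tilted fun y => γ * s y) = tiltedMean P t γ s x := by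
  rw [integral_tilted, tiltedMean, meanYW, condMean, ← integral_div]
  refine integral_congr_ae (ae_of_all _ fun y => ?_)
  simp only [meanW, condMean, weight, smul_eq_mul]
  ring

/-- Triangle inequality around the tilted mean; both bounds are integrable over the arm 1 - t, which
gives integrability of Y(t) there. -/
lemma integral_abs_tilted_le {x : 𝒳} (hw : Integrable (weight γ s) (condLawY P t x))
    (hyw : Integrable (fun y => y * weight γ s y) (condLawY P t x)) :
    ∫ y, |y| ∂((condLawY P t x).tilted fun y => γ * s y)
      ≤ tiltedDeviation P t γ s x + |tiltedMean P t γ s x| := by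
  have hprob : IsProbabilityMeasure ((condLawY P t x).tilted fun y => γ * s y) :=
    isProbabilityMeasure_tilted hw
  have hi := tilted_integrable_id hw hyw
  have hdev : ∫ y, |y - tiltedMean P t γ s x| ∂((condLawY P t x).tilted fun y => γ * s y)
      = tiltedDeviation P t γ s x := by
    rw [integral_tilted, tiltedDeviation, ← integral_div]
    refine integral_congr_ae (ae_of_all _ fun y => ?_)
    simp only [meanW, condMean, weight, smul_eq_mul]
    ring
  have hi' : Integrable (fun y => |y - tiltedMean P t γ s x|)
      ((condLawY P t x).tilted fun y => γ * s y) := (hi.sub (integrable_const _)).abs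
  rw [← hdev]
  have hc : |tiltedMean P t γ s x|
      = ∫ _, |tiltedMean P t γ s x| ∂((condLawY P t x).tilted fun y => γ * s y) := by simp
  rw [hc, ← integral_add hi' (integrable_const _)]
  refine integral_mono hi.abs (hi'.add (integrable_const _)) fun y => ?_
  have := abs_add_le (y - tiltedMean P t γ s x) (tiltedMean P t γ s x)
  simpa using this

/-- Treating (X, T, Y(t)) as observed data with law Q lets the arm calculus apply to the potential
outcome as it does to Y. -/
theorem integrable_and_integral_potential_outcome (hs : Measurable s) (hP : IsRegularLaw t γ s P)
    [IsProbabilityMeasure μ] {Ypot : Fin 2 → Ω → ℝ} (h : IsTiltingModel t γ s P μ X T Y Ypot) :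
    Integrable (Ypot t) μ ∧ ∫ ω, Ypot t ω ∂μ = psi t γ s P := by
  have hX := h.measurable_X
  have hT := h.measurable_T
  have hY := h.measurable_Y
  have hW := h.measurable_Ypot t
  have hZ : Measurable fun ω => (X ω, T ω, Ypot t ω) := by fun_prop
  obtain ⟨Q, hQ⟩ : ∃ Q : ProbabilityMeasure (Obs 𝒳),
      μ.map (fun ω => (X ω, T ω, Ypot t ω)) = (Q : Measure (Obs 𝒳)) :=
    ⟨⟨_, Measure.isProbabilityMeasure_map hZ.aemeasurable⟩, rfl⟩
  have hXlaw : μ.map X = lawX P := by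
    rw [lawX, ← h.law, Measure.map_map measurable_covX (by fun_prop)]
    rfl
  have harmX : ∀ t', armX Q t' = armX P t' := fun t' => by
    ext A hA
    rw [armX_apply_of_map hX hT hW hQ t' hA, armX_apply_of_map hX hT hY h.law t' hA]
  have harmXY : armXY Q t = armXY P t := by
    ext A hA
    rw [armXY_apply_of_map hX hT hW hQ t hA, armXY_apply_of_map hX hT hY h.law t hA]
    -- On the event T = t, consistency gives Y(t) = Y almost surely.
    refine measure_congr ?_
    filter_upwards [h.consistency] with ω hω
    refine propext (and_congr_left fun hTω => ?_)
    have hTω' : T ω = t := hTω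
    rw [hTω'] at hω
    simp only [Set.mem_preimage, hω]
  have hκ : ∀ᵐ x ∂(armX P t), condLawY Q t x = condLawY P t x := by
    rw [← harmX]
    refine condKernelY_ae_eq (η := condKernelY P t) ?_
    rw [harmXY, harmX, armXY_eq_compProd]
  have htilt : ∀ᵐ x ∂(lawX P), condLawY Q (1 - t) x
      = (condLawY P t x).tilted fun y => γ * s y := by
    have h1 := h.tilting
    rw [hXlaw] at h1
    filter_upwards [h1, (lawX_absolutelyContinuous_armX (hP.positivity t)).ae_le hκ] with x hx hx'
    rw [condLawY_of_map hX hT hW hQ, hx, ← condLawY_of_map hX hT hW hQ, hx']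
  have hle := (Measure.absolutelyContinuous_of_le (armX_le_lawX P (1 - t))).ae_le
  have iY : Integrable (fun o => if trtT o = t then outY o else 0) (P : Measure (Obs 𝒳)) :=
    hP.memLp_outcome.integrable one_le_two
  have iρ : Integrable (fun o => if trtT o = 1 - t then tiltedMean P t γ s (covX o) else 0)
      (P : Measure (Obs 𝒳)) := hP.memLp_tiltedMean.integrable one_le_two
  have iρX := (integrable_arm_covX_iff P (1 - t) (measurable_tiltedMean P t γ hs)).1 iρ
  have i1 : Integrable (fun o => if trtT o = t then outY o else 0) (Q : Measure (Obs 𝒳)) := by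
    rw [integrable_arm_iff Q t measurable_outY, ← armXY_eq_compProd, harmXY, armXY_eq_compProd,
      ← integrable_arm_iff P t measurable_outY]
    exact iY
  have i2 : Integrable (fun o => if trtT o = 1 - t then outY o else 0)
      (Q : Measure (Obs 𝒳)) := by
    rw [integrable_arm_iff Q (1 - t) measurable_outY, Measure.integrable_compProd_iff
      (measurable_section measurable_outY _).aestronglyMeasurable, harmX]
    simp only [condKernelY_apply, outY, Real.norm_eq_abs]
    constructor
    · filter_upwards [hle htilt, hle hP.integrable_weight, hle hP.integrable_mul_weight]
        with x hx hw hyw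
      rw [hx]
      exact tilted_integrable_id hw hyw
    · refine ((integrable_tiltedDeviation hs hP).add iρX.abs).mono'
        (measurable_condMean Q (1 - t) measurable_abs).aestronglyMeasurable ?_
      filter_upwards [hle htilt, hle hP.integrable_weight, hle hP.integrable_mul_weight]
        with x hx hw hyw
      rw [Real.norm_of_nonneg (integral_nonneg fun y => abs_nonneg y), hx]
      exact integral_abs_tilted_le hw hyw
  obtain ⟨hint, hval⟩ := integral_split Q t i1 i2
  rw [← hQ] at hint
  refine ⟨hint.comp_measurable hZ, ?_⟩
  have e0 : ∫ ω, Ypot t ω ∂μ = ∫ o, outY o ∂(Q : Measure (Obs 𝒳)) := by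
    rw [← hQ, integral_map hZ.aemeasurable measurable_outY.aestronglyMeasurable]
    rfl
  rw [e0, hval, psi_eq_add hs iY iρ, integral_arm Q t measurable_outY i1,
    integral_arm Q (1 - t) measurable_outY i2, integral_arm P t measurable_outY iY,
    integral_arm_covX P (1 - t) (measurable_tiltedMean P t γ hs), harmX, harmX]
  congr 1
  · refine integral_congr_ae ?_
    filter_upwards [hκ] with x hx
    rw [hx]
  · refine integral_congr_ae ?_
    filter_upwards [hle htilt] with x hx
    rw [hx]
    exact integral_id_tilted P t γ s x

end Identification

lemma isEfficientInfluenceFunction_phi {𝒳 : Type*} [MeasurableSpace 𝒳] {t : Fin 2} {γ : ℝ}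
    {s : ℝ → ℝ} (hs : Measurable s) {P : ProbabilityMeasure (Obs 𝒳)}
    (hP : IsRegularLaw t γ s P) :
    IsEfficientInfluenceFunction (psi t γ s) P (phi t γ s P) where
  memLp := memLp_phi hP
  mean_zero := integral_phi hs hP
  hasDerivAt _ _ h := hasDerivAt_psi hs hP h
  mem_tangentSpace := mem_tangentSpace_of_integral_eq_zero (memLp_phi hP) (integral_phi hs hP)

end TiltSens

theorem theorem1 {𝒳 : Type*} [MeasurableSpace 𝒳] (t : Fin 2) (γ : ℝ) (s : ℝ → ℝ)
    (hs : Measurable s) (P : ProbabilityMeasure (TiltSens.Obs 𝒳))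
    (hP : TiltSens.IsRegularLaw t γ s P) :
    (∀ (Ω : Type*) [MeasurableSpace Ω] (μ : Measure Ω) [IsProbabilityMeasure μ]
        (X : Ω → 𝒳) (T : Ω → Fin 2) (Y : Ω → ℝ) (Ypot : Fin 2 → Ω → ℝ),
        TiltSens.IsTiltingModel t γ s P μ X T Y Ypot →
        Integrable (Ypot t) μ ∧ ∫ ω, Ypot t ω ∂μ = TiltSens.psi t γ s P) ∧
    TiltSens.IsEfficientInfluenceFunction (TiltSens.psi t γ s) P (TiltSens.phi t γ s P) ∧
    (∀ φ' : TiltSens.Obs 𝒳 → ℝ, TiltSens.IsInfluenceFunction (TiltSens.psi t γ s) P φ' →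
        φ' =ᵐ[(P : Measure (TiltSens.Obs 𝒳))] TiltSens.phi t γ s P) := by
  have hφ := TiltSens.isEfficientInfluenceFunction_phi hs hP
  refine ⟨?_, hφ, fun φ' hφ' => hφ'.ae_eq hφ.toIsInfluenceFunction⟩
  intro Ω _ μ _ X T Y Ypot h
  exact TiltSens.integrable_and_integral_potential_outcome hs hP h
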